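/- Let $\Gamma$ be a finite group (written additively, not necessarily abelian) and let $g,r\in\Gamma$ be such that $0\notin\{g,r,2g,2r\}$, $g\notin\{r,-r\}$ and $g+r=r+g$. Call a simple $5$-regular graph $G$ with vertex set $\Gamma$ a *$\{g,r\}$-graph* if it contains as a spanning subgraph the Cayley graph on $\Gamma$ in which every vertex $v$ is adjacent precisely to $v+g$, $v-g$, $v+r$ and $v-r$. A *$P_5$-decomposition* of $G$ is a set of pairwise edge-disjoint subgraphs of $G$ that together cover $E(G)$, each of which is a path with exactly $5$ edges (on $6$ distinct vertices). **Theorem.** Every $\{g,r\}$-graph for which $2g+2r\neq 0$ admits a $P_5$-decomposition. **Corollary.** Every $\{g,r\}$-graph for which $2g+2r\neq 0$ or $2g-2r\neq 0$ admits a $P_5$-decomposition. -/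

import Mathlib

/-- A decomposition of a graph `G`: a set of pairwise edge-disjoint subgraphs of `G` that
together cover the edge set of `G`. -/
structure SimpleGraph.IsDecomposition {V : Type*} (G : SimpleGraph V) (D : Set G.Subgraph) :
    Prop where
  edgeDisjoint : D.PairwiseDisjoint SimpleGraph.Subgraph.edgeSet
  cover : ⋃ T ∈ D, T.edgeSet = G.edgeSet

/-- `G` admits an `H`-decomposition: a decomposition all of whose elements are isomorphic
to `H`. -/
def SimpleGraph.AdmitsDecomposition {V W : Type*} (G : SimpleGraph V) (H : SimpleGraph W) :
    Prop :=
  ∃ D : Set G.Subgraph, G.IsDecomposition D ∧ ∀ T ∈ D, Nonempty (T.coe ≃g H)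

/-- The simple path with `ℓ` edges (hence `ℓ + 1` vertices). -/
def pathOfLength (ℓ : ℕ) : SimpleGraph (Fin (ℓ + 1)) :=
  SimpleGraph.pathGraph (ℓ + 1)

/-- `{g, r}` is a simple commutative generator (SCG) of the additively written, not
necessarily commutative, group `Γ`. -/
structure IsSimpleCommutativeGenerator {Γ : Type*} [AddGroup Γ] (g r : Γ) : Prop where
  zero_notMem : (0 : Γ) ∉ ({g, r, 2 • g, 2 • r} : Set Γ)
  notMem : g ∉ ({r, -r} : Set Γ)
  comm : g + r = r + g

/-- The Cayley graph generated by `{g, r}`: the neighbours of a vertex `v` are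
`v + g`, `v - g`, `v + r` and `v - r`. -/
def generatedGraph {Γ : Type*} [AddGroup Γ] (g r : Γ) : SimpleGraph Γ :=
  SimpleGraph.addCayley ({g, -g, r, -r} : Set Γ)

/-- `G` is a `{g, r}`-graph: `{g, r}` is an SCG, and `G` is a simple `5`-regular graph with
vertex set `Γ` that contains the (spanning) Cayley graph generated by `{g, r}`. -/
structure IsGeneratedGraph {Γ : Type*} [AddGroup Γ] (g r : Γ) (G : SimpleGraph Γ)
    [G.LocallyFinite] : Prop where
  scg : IsSimpleCommutativeGenerator g r
  regular : G.IsRegularOfDegree 5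
  contains : generatedGraph g r ≤ G

/-! Outside the Cayley graph, `G` is a perfect matching `M`, and a decomposition needs one path per
matching edge. Only right translations by `g` and `r` matter, so the group may be taken abelian
(`exists_equiv_addCommGroup`). Let each vertex `x` own the trail `x, x + g, x + g + r`. These trails
partition the Cayley edges, and a matching edge together with the trails at its two ends has five
edges. They form a path unless the edge is a diagonal, `M v = v + g + r`; then the trail at `v`
closes up to a triangle. Since `2g + 2r ≠ 0`, an edge is a diagonal from at most one of its ends.

Diagonals are repaired by exchanging edges with nearby paths. What can be exchanged depends on
whether there is also a diagonal at `v - g` (`back`) or at `v + r` (`up`); both cannot occur. This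
successor relation is injective, so the task becomes a tiling problem for cyclic words in `back`,
`up`, `halt`: blocks have one to four members, and a block of two or four lends an edge upwards,
which a `relay` uses if there is a diagonal there. `exists_tiled` solves it unless all letters are
`back`, where a uniform shift (`row`) works.

Disjointness comes for free: half as many paths as vertices cannot cover all edges and overlap. It
remains that every route is a path (`isRoute_route`, `isRoute_pair`) and that all edges are covered
(`covered_left`, `covered_right`, `covered_matching`). The corollary replaces `r` by `-r`. -/

/-! ### Tiling cyclic words by blocks of roles -/

/-- The possible successors of a square-type matching edge. -/
inductive Step
  | back
  | up
  | halt
  deriving DecidableEq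

/-- The part that a square-type matching edge plays in the rerouting of trails. -/
inductive Role
  | single
  | pairFst
  | pairSnd
  | relay
  | tripFst
  | tripSnd
  | tripThd
  | quadFst
  | quadSnd
  | quadThd
  | quadFth
  | row
  deriving DecidableEq

namespace Role

/-- The roles with which a new block begins. -/
def IsStart (a : Role) : Prop :=
  a = single ∨ a = pairFst ∨ a = tripFst ∨ a = quadFst

/-- The roles that hand a trail over to the vertex above them. -/
def Lends (a : Role) : Prop :=
  a = pairSnd ∨ a = quadFth

/-- `Trans a l b`: the role `a` may be followed, along a step of type `l`, by the role `b`. -/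
def Trans (a : Role) (l : Step) (b : Role) : Prop :=
  match a with
  | single => l ≠ .back ∧ b.IsStart
  | pairFst => l = .back ∧ b = pairSnd
  | pairSnd => (l = .up ∧ b = relay) ∨ (l ≠ .up ∧ b.IsStart)
  | relay => b.IsStart
  | tripFst => l = .back ∧ b = tripSnd
  | tripSnd => l = .back ∧ b = tripThd
  | tripThd => b.IsStart
  | quadFst => l = .back ∧ b = quadSnd
  | quadSnd => l = .up ∧ b = quadThd
  | quadThd => l = .back ∧ b = quadFth
  | quadFth => (l = .up ∧ b = relay) ∨ (l ≠ .up ∧ b.IsStart)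
  | row => l = .back ∧ b = row

/-- A sequence of roles from role `a` at `i` to role `b` at `j` that is compatible with `w`. -/
def Walk (w : ℕ → Step) (i : ℕ) (a : Role) (j : ℕ) (b : Role) : Prop :=
  ∃ s : ℕ → Role, s i = a ∧ s j = b ∧ ∀ k, i ≤ k → k < j → Trans (s k) (w k) (s (k + 1))

theorem Walk.single_step {w : ℕ → Step} {i : ℕ} {a b : Role} (h : Trans a (w i) b) :
    Walk w i a (i + 1) b := by
  refine ⟨fun k => if k = i then a else b, by simp, by simp, fun k h1 h2 => ?_⟩
  obtain rfl : k = i := by omega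
  simpa using h

theorem Walk.trans {w : ℕ → Step} {i j k : ℕ} {a b c : Role} (hij : i ≤ j) (hjk : j ≤ k)
    (h : Walk w i a j b) (h' : Walk w j b k c) : Walk w i a k c := by
  obtain ⟨s, hs1, hs2, hs3⟩ := h
  obtain ⟨t, ht1, ht2, ht3⟩ := h'
  refine ⟨fun m => if m ≤ j then s m else t m, by simp [hij, hs1], ?_, fun m h1 h2 => ?_⟩
  · rcases hjk.eq_or_lt with rfl | h
    · simp [hs2, ← ht2, ht1]
    · simp [not_le.2 h, ht2]
  · rcases lt_trichotomy m j with h | rfl | h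
    · simpa [h.le, Nat.succ_le_iff.2 h] using hs3 m h1 h
    · simpa [hs2, ← ht1] using ht3 m le_rfl h2
    · have : ¬ m ≤ j := by omega
      have h' : ¬ m + 1 ≤ j := by omega
      simpa [this, h'] using ht3 m h.le h2

/-- The interval `[i, j)` can be split into blocks. -/
def Tiled (w : ℕ → Step) (i j : ℕ) : Prop :=
  i ≤ j ∧ ∃ a : Role, a.IsStart ∧ ∀ b : Role, b.IsStart → Walk w i a j b

theorem Tiled.trans {w : ℕ → Step} {i j k : ℕ} (h : Tiled w i j) (h' : Tiled w j k) :
    Tiled w i k := by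
  obtain ⟨hij, a, ha, h⟩ := h
  obtain ⟨hjk, b, hb, h'⟩ := h'
  exact ⟨hij.trans hjk, a, ha, fun c hc => (h b hb).trans hij hjk (h' c hc)⟩

theorem tiled_one {w : ℕ → Step} {i : ℕ} (h : w i ≠ .back) : Tiled w i (i + 1) :=
  ⟨by omega, single, .inl rfl, fun _ hb => Walk.single_step ⟨h, hb⟩⟩

theorem tiled_two {w : ℕ → Step} {i : ℕ} (h : w i = .back) (h' : w (i + 1) ≠ .up) :
    Tiled w i (i + 2) :=
  ⟨by omega, pairFst, .inr (.inl rfl), fun b hb =>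
    Walk.trans (by omega) (by omega) (Walk.single_step (b := pairSnd) ⟨h, rfl⟩)
      (Walk.single_step (.inr ⟨h', hb⟩))⟩

/-- A triple fits `back, back`, a pair with relay fits `back, up`. The third step is free, as
neither `tripThd` nor `relay` restricts it. -/
theorem tiled_three {w : ℕ → Step} {i : ℕ} (h : w i = .back) (h' : w (i + 1) ≠ .halt) :
    Tiled w i (i + 3) := by
  cases h1 : w (i + 1) with
  | halt => exact absurd h1 h'
  | back =>
    exact ⟨by omega, tripFst, .inr (.inr (.inl rfl)), fun b hb =>
      Walk.trans (by omega) (by omega) (Walk.single_step (b := tripSnd) ⟨h, rfl⟩)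
        (Walk.trans (by omega) (by omega) (Walk.single_step (b := tripThd) ⟨h1, rfl⟩)
          (Walk.single_step hb))⟩
  | up =>
    exact ⟨by omega, pairFst, .inr (.inl rfl), fun b hb =>
      Walk.trans (by omega) (by omega) (Walk.single_step (b := pairSnd) ⟨h, rfl⟩)
        (Walk.trans (by omega) (by omega) (Walk.single_step (b := relay) (.inl ⟨h1, rfl⟩))
          (Walk.single_step hb))⟩

theorem walk_quad {w : ℕ → Step} {i : ℕ} (h0 : w i = .back) (h1 : w (i + 1) = .up)
    (h2 : w (i + 2) = .back) : Walk w i quadFst (i + 3) quadFth :=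
  Walk.trans (by omega) (by omega) (Walk.single_step (b := quadSnd) ⟨h0, rfl⟩)
    (Walk.trans (by omega) (by omega) (Walk.single_step (b := quadThd) ⟨h1, rfl⟩)
      (Walk.single_step ⟨h2, rfl⟩))

theorem tiled_four {w : ℕ → Step} {i : ℕ} (h0 : w i = .back) (h1 : w (i + 1) = .up)
    (h2 : w (i + 2) = .back) (h3 : w (i + 3) ≠ .up) : Tiled w i (i + 4) :=
  ⟨by omega, quadFst, .inr (.inr (.inr rfl)), fun _ hb =>
    Walk.trans (by omega) (by omega) (walk_quad h0 h1 h2) (Walk.single_step (.inr ⟨h3, hb⟩))⟩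

theorem tiled_five {w : ℕ → Step} {i : ℕ} (h0 : w i = .back) (h1 : w (i + 1) = .up)
    (h2 : w (i + 2) = .back) (h3 : w (i + 3) = .up) : Tiled w i (i + 5) :=
  ⟨by omega, quadFst, .inr (.inr (.inr rfl)), fun _ hb =>
    Walk.trans (by omega) (by omega) (walk_quad h0 h1 h2)
      (Walk.trans (by omega) (by omega) (Walk.single_step (b := relay) (.inl ⟨h3, rfl⟩))
        (Walk.single_step hb))⟩

/-- Greedy tiling up to a step that is not `back` overshoots by at most one position. -/
theorem tiled_or_overshoot {w : ℕ → Step} {t : ℕ} (ht : w t ≠ .back) (n : ℕ) :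
    ∀ q, q ≤ t → t - q = n → Tiled w q (t + 1) ∨ (w t = .up ∧ Tiled w q (t + 2)) := by
  induction n using Nat.strong_induction_on with
  | _ n ih =>
    intro q hq hn
    by_cases hw : w q = .back
    · have hqt : q < t := lt_of_le_of_ne hq (by rintro rfl; exact ht hw)
      by_cases hs : w (q + 1) = .halt
      · have h2 := tiled_two hw (by simp [hs])
        by_cases hq2 : q + 2 ≤ t
        · rcases ih (t - (q + 2)) (by omega) (q + 2) hq2 rfl with h | ⟨h, h'⟩
          · exact .inl (h2.trans h)
          · exact .inr ⟨h, h2.trans h'⟩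
        · obtain rfl : t = q + 1 := by omega
          exact .inl h2
      · have h3 := tiled_three hw hs
        by_cases hq3 : q + 3 ≤ t
        · rcases ih (t - (q + 3)) (by omega) (q + 3) hq3 rfl with h | ⟨h, h'⟩
          · exact .inl (h3.trans h)
          · exact .inr ⟨h, h3.trans h'⟩
        · obtain rfl | rfl : t = q + 2 ∨ t = q + 1 := by omega
          · exact .inl h3
          · refine .inr ⟨?_, h3⟩
            cases h : w (q + 1) <;> simp_all
    · have h1 := tiled_one hw
      rcases hq.eq_or_lt with rfl | hqt
      · exact .inl h1
      · rcases ih (t - (q + 1)) (by omega) (q + 1) hqt rfl with h | ⟨h, h'⟩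
        · exact .inl (h1.trans h)
        · exact .inr ⟨h, h1.trans h'⟩

/-- If tilings from `p + 1` and from `p + 2` meet at `q`, the greedy continuation from `q` ends one
period after one of the two starts. The second alternative in `h1` stands for a start at `q` itself,
because an empty interval is not `Tiled`. -/
theorem exists_tiled_of_merge {w : ℕ → Step} {N p q : ℕ} (hN : 0 < N) (hw : w (p + N) ≠ .back)
    (hq : q ≤ p + N + 2) (h0 : Tiled w (p + 1) q)
    (h1 : Tiled w (p + 2) q ∨ w (p + 1) ≠ .back ∧ q = p + 2) : ∃ i, Tiled w i (i + N) := by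
  have key : Tiled w q (p + N + 1) ∨ Tiled w q (p + N + 2) ∨ q = p + N + 1 ∨ q = p + N + 2 := by
    by_cases h : q ≤ p + N
    · rcases tiled_or_overshoot hw _ q h rfl with h | h
      · exact .inl h
      · exact .inr (.inl h.2)
    · omega
  rcases key with h | h | rfl | rfl
  · exact ⟨p + 1, by simpa [add_right_comm] using h0.trans h⟩
  · refine ⟨p + 2, ?_⟩
    rcases h1 with h1 | ⟨-, rfl⟩
    · simpa [add_right_comm] using h1.trans h
    · simpa [add_right_comm] using h
  · exact ⟨p + 1, by simpa [add_right_comm] using h0⟩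
  · rcases h1 with h1 | ⟨-, h⟩
    · exact ⟨p + 2, by simpa [add_right_comm] using h1⟩
    · omega

/-- After a `halt`, greedy tiling closes up, since it cannot overshoot the next copy of that `halt`.
Without `halt`, failure of merging forces `back, back, up` after every `up`, and this word is tiled
by triples. The hypothesis `h2` excludes the alternating word of period two, which has no tiling. -/
theorem exists_tiled {w : ℕ → Step} {N : ℕ} (hN : 0 < N) (hw : ∀ i, w (i + N) = w i)
    (hr : ∃ i, w i ≠ .back) (h2 : N = 2 → ∀ i, w i = .back → w (i + 1) ≠ .up) :
    ∃ i, Tiled w i (i + N) := by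
  by_contra hcon
  obtain ⟨i₀, hi₀⟩ := hr
  have hhalt : ∀ i, w i ≠ .halt := by
    intro i hi
    have hi' : w (i + N) = .halt := by rw [hw, hi]
    rcases tiled_or_overshoot (w := w) (t := i + N) (by simp [hi']) _ (i + 1) (by omega) rfl
      with h | h
    · exact hcon ⟨i + 1, by simpa [add_right_comm] using h⟩
    · simp [hi'] at h
  have hmerge : ∀ p q, w p ≠ .back → q ≤ p + N + 2 → Tiled w (p + 1) q →
      Tiled w (p + 2) q ∨ w (p + 1) ≠ .back ∧ q = p + 2 → False := fun p q hp hq h h' =>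
    hcon (exists_tiled_of_merge hN (by rwa [hw]) hq h h')
  have hup : ∀ i, w i ≠ .back → w i = .up := by
    intro i hi
    cases h : w i with
    | back => exact absurd h hi
    | up => rfl
    | halt => exact absurd h (hhalt i)
  have hper : ∀ p, w p = .up →
      w (p + 1) = .back ∧ w (p + 2) = .back ∧ w (p + 3) = .up := by
    intro p hp
    have hpN := hw p
    have hp' : w p ≠ .back := by simp [hp]
    have b1 : w (p + 1) = .back := by
      by_contra h
      exact hmerge p (p + 2) hp' (by omega) (tiled_one h) (.inr ⟨h, rfl⟩)
    have hN1 : N ≠ 1 := by rintro rfl; simp_all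
    have b2 : w (p + 2) = .back := by
      by_contra h
      have u2 := hup _ h
      -- One block from `p + 1` and two from `p + 2` meet at `p + 4`, `p + 5` or `p + 6`, according
      -- to the next letters. Excluding small `N` keeps the meeting point within `p + N + 2`.
      have t3 : Tiled w (p + 1) (p + 4) := tiled_three b1 (by simp [u2])
      have t1 : Tiled w (p + 2) (p + 3) := tiled_one h
      have hN2 : N ≠ 2 := fun hN2 => h2 hN2 (p + 1) b1 u2
      by_cases h3 : w (p + 3) = .back
      · have hN3 : N ≠ 3 := by rintro rfl; simp_all
        by_cases h4 : w (p + 4) = .back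
        · exact hmerge p (p + 5) hp' (by omega)
            (tiled_four b1 u2 h3 (by simp [h4])) (.inl (t1.trans (tiled_two h3 (by simp [h4]))))
        · have u4 := hup _ h4
          exact hmerge p (p + 6) hp' (by omega)
            (tiled_five b1 u2 h3 u4) (.inl (t1.trans (tiled_three h3 (by simp [u4]))))
      · exact hmerge p (p + 4) hp' (by omega) t3 (.inl (t1.trans (tiled_one h3)))
    refine ⟨b1, b2, hup _ fun b3 => ?_⟩
    exact hmerge p (p + 4) hp' (by omega) (tiled_three b1 (by simp [b2]))
      (.inl (tiled_two b2 (by simp [b3])))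
  have hi := hup _ hi₀
  have h3 : ∀ k, w (i₀ + 3 * k) = .up ∧ (0 < k → Tiled w (i₀ + 1) (i₀ + 3 * k + 1)) := by
    intro k
    induction k with
    | zero => simpa using hi
    | succ k ih =>
      obtain ⟨hk, hT⟩ := ih
      obtain ⟨b1, b2, b3⟩ := hper _ hk
      have t : Tiled w (i₀ + 3 * k + 1) (i₀ + 3 * (k + 1) + 1) := tiled_three b1 (by simp [b2])
      refine ⟨b3, fun _ => ?_⟩
      rcases k.eq_zero_or_pos with rfl | hk0
      · exact t
      · exact (hT hk0).trans t
  -- Unless 3 divides `N`, the letter at `i₀ + N` is one of the two `back`s after this `up`, against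
  -- periodicity.
  obtain ⟨b1, b2, -⟩ := hper _ (h3 (N / 3)).1
  have hwN := hw i₀
  rw [hi] at hwN
  have hmod : N % 3 = 0 ∨ N % 3 = 1 ∨ N % 3 = 2 := by omega
  rcases hmod with h | h | h
  · refine hcon ⟨i₀ + 1, ?_⟩
    have := (h3 (N / 3)).2 (by omega)
    rwa [show i₀ + 3 * (N / 3) + 1 = i₀ + 1 + N by omega] at this
  · rw [show i₀ + 3 * (N / 3) + 1 = i₀ + N by omega, hwN] at b1
    cases b1
  · rw [show i₀ + 3 * (N / 3) + 2 = i₀ + N by omega, hwN] at b2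
    cases b2

/-- Periodic sequences of steps carry compatible periodic sequences of roles. -/
theorem exists_periodic {w : ℕ → Step} {N : ℕ} (hN : 0 < N) (hw : ∀ i, w (i + N) = w i)
    (h2 : N = 2 → ∀ i, w i = .back → w (i + 1) ≠ .up) :
    ∃ s : ℕ → Role, (∀ i, s (i + N) = s i) ∧ ∀ i, Trans (s i) (w i) (s (i + 1)) := by
  by_cases hr : ∃ i, w i ≠ .back
  swap
  · push Not at hr
    exact ⟨fun _ => row, fun _ => rfl, fun i => ⟨hr i, rfl⟩⟩
  obtain ⟨p, hp, a, ha, hwalk⟩ := exists_tiled hN hw hr h2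
  obtain ⟨s, hs0, hs1, hs⟩ := hwalk a ha
  have hwm : ∀ i k, w (i + N * k) = w i := by
    intro i k
    induction k with
    | zero => rfl
    | succ k ih => rw [mul_add, mul_one, ← add_assoc, hw, ih]
  -- Modulo `N`, the summand `p * (N - 1)` is `-p`, so this is the periodic extension of `s` from
  -- `[p, p + N)`.
  refine ⟨fun k => s (p + (k + p * (N - 1)) % N), fun i => ?_, fun i => ?_⟩
  · simp [add_right_comm i N]
  · dsimp only
    set m := i + p * (N - 1) with hm
    have hlt := Nat.mod_lt m hN
    have hwi : w (p + m % N) = w i := by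
      have h1 : p + m % N + N * (m / N) = i + N * p := by
        have := Nat.mod_add_div m N
        obtain ⟨N, rfl⟩ : ∃ k, N = k + 1 := ⟨N - 1, by omega⟩
        simp only [Nat.add_sub_cancel] at hm
        nlinarith
      rw [← hwm _ (m / N), h1, hwm]
    have hstep := hs (p + m % N) (by omega) (by omega)
    rw [hwi] at hstep
    rw [add_right_comm i 1, ← hm]
    by_cases hlast : m % N + 1 < N
    · rw [← Nat.mod_add_mod m, Nat.mod_eq_of_lt hlast]
      exact hstep
    -- At the seam both ends of the tiling carry the same role `a`.
    · have : (m + 1) % N = 0 := by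
        have h' : m % N + 1 = N := by omega
        rw [← Nat.mod_add_mod m, h', Nat.mod_self]
      rw [this, add_zero, hs0, ← hs1]
      convert hstep using 2
      omega

theorem Trans.of_pairSnd {a : Role} {l : Step} (h : Trans a l .pairSnd) :
    l = .back ∧ a = .pairFst := by
  cases a <;> simp_all [Trans, IsStart]

theorem Trans.of_tripSnd {a : Role} {l : Step} (h : Trans a l .tripSnd) :
    l = .back ∧ a = .tripFst := by
  cases a <;> simp_all [Trans, IsStart]

theorem Trans.of_tripThd {a : Role} {l : Step} (h : Trans a l .tripThd) :
    l = .back ∧ a = .tripSnd := by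
  cases a <;> simp_all [Trans, IsStart]

theorem Trans.of_quadSnd {a : Role} {l : Step} (h : Trans a l .quadSnd) :
    l = .back ∧ a = .quadFst := by
  cases a <;> simp_all [Trans, IsStart]

theorem Trans.of_quadThd {a : Role} {l : Step} (h : Trans a l .quadThd) :
    l = .up ∧ a = .quadSnd := by
  cases a <;> simp_all [Trans, IsStart]

theorem Trans.of_quadFth {a : Role} {l : Step} (h : Trans a l .quadFth) :
    l = .back ∧ a = .quadThd := by
  cases a <;> simp_all [Trans, IsStart]

theorem Trans.of_row {a : Role} {l : Step} (h : Trans a l .row) :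
    l = .back ∧ a = .row := by
  cases a <;> simp_all [Trans, IsStart]

theorem Trans.of_relay {a : Role} {l : Step} (h : Trans a l .relay) : l = .up ∧ a.Lends := by
  cases a <;> simp_all [Trans, IsStart, Lends]

theorem Lends.trans_up {a b : Role} (ha : a.Lends) (h : Trans a .up b) : b = .relay := by
  rcases ha with rfl | rfl <;> simpa [Trans] using h

theorem Lends.trans_back {a b : Role} (ha : a.Lends) (h : Trans a .back b) : b.IsStart := by
  rcases ha with rfl | rfl <;> simpa [Trans] using h

end Role

/-! ### Roles on the cycles of a permutation -/

/-- Each cycle, read from a chosen representative, is a periodic word. The position of `v` is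
defined only modulo the period, which suffices for a periodic sequence of roles. -/
theorem Equiv.Perm.exists_role {W : Type*} [Finite W] (π : Equiv.Perm W) (L : W → Step)
    (h : ∀ v, π (π v) = v → L v = .back → L (π v) ≠ .up) :
    ∃ ρ : W → Role, ∀ v, Role.Trans (ρ v) (L v) (ρ (π v)) := by
  have key : ∀ x, ∃ s : ℕ → Role, (∀ i, s (i + Function.minimalPeriod π x) = s i) ∧
      ∀ i, Role.Trans (s i) (L (π^[i] x)) (s (i + 1)) := by
    intro x
    have hx : x ∈ Function.periodicPts π := π.injective.mem_periodicPts x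
    refine Role.exists_periodic (Function.minimalPeriod_pos_of_mem_periodicPts hx)
      (fun i => by rw [Function.iterate_add_minimalPeriod_eq]) fun hN i hi => ?_
    rw [Function.iterate_succ_apply']
    refine h _ ?_ hi
    rw [← Function.iterate_succ_apply' π, ← Function.iterate_succ_apply' π]
    have := Function.iterate_add_minimalPeriod_eq (f := π) (x := x) (n := i)
    rwa [hN] at this
  choose s hs1 hs2 using key
  let rep : W → W := fun v => (Quotient.mk (Equiv.Perm.SameCycle.setoid π) v).out
  have hrep : ∀ v, ∃ i : ℕ, π^[i] (rep v) = v := by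
    intro v
    have h1 : Equiv.Perm.SameCycle π (rep v) v :=
      Quotient.exact (s := Equiv.Perm.SameCycle.setoid π) (Quotient.out_eq _)
    obtain ⟨i, hi⟩ := h1.exists_nat_pow_eq
    exact ⟨i, by rw [Equiv.Perm.iterate_eq_pow, hi]⟩
  choose idx hidx using hrep
  refine ⟨fun v => s (rep v) (idx v), fun v => ?_⟩
  have h1 : rep (π v) = rep v := by
    have : Quotient.mk (Equiv.Perm.SameCycle.setoid π) (π v) =
        Quotient.mk (Equiv.Perm.SameCycle.setoid π) v :=
      Quotient.sound (Equiv.Perm.sameCycle_apply_left.2 (Equiv.Perm.SameCycle.refl π v))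
    simp only [rep, this]
  have h2 : s (rep v) (idx (π v)) = s (rep v) (idx v + 1) := by
    have h3 : idx (π v) ≡ idx v + 1 [MOD Function.minimalPeriod π (rep v)] := by
      have hx : rep v ∈ Function.periodicPts π := π.injective.mem_periodicPts _
      have h4 : π^[idx (π v)] (rep v) = π^[idx v + 1] (rep v) := by
        rw [Function.iterate_succ_apply', hidx, ← h1, hidx]
      rw [← Function.iterate_mod_minimalPeriod_eq,
        ← Function.iterate_mod_minimalPeriod_eq (n := idx v + 1)] at h4
      have hp := Function.minimalPeriod_pos_of_mem_periodicPts hx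
      exact Function.iterate_injOn_Iio_minimalPeriod (Nat.mod_lt _ hp) (Nat.mod_lt _ hp) h4
    have hper : Function.Periodic (s (rep v)) (Function.minimalPeriod π (rep v)) := hs1 _
    rw [← hper.map_mod_nat, h3, hper.map_mod_nat]
  have := hs2 (rep v) (idx v)
  rw [hidx] at this
  simpa only [h1, h2] using this

/-! ### Diagonals and their role assignment -/

/-- `M` is a perfect matching, given as an involution, without common edges with the graph
generated by `g` and `r`, in a group in which the latter is generic enough. -/
structure IsCrossMatching {W : Type*} [AddCommGroup W] (g r : W) (M : W → W) : Prop where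
  invol : ∀ v, M (M v) = v
  ne_self : ∀ v, M v ≠ v
  ne_add_left : ∀ v, M v ≠ v + g
  ne_sub_left : ∀ v, M v ≠ v - g
  ne_add_right : ∀ v, M v ≠ v + r
  ne_sub_right : ∀ v, M v ≠ v - r
  left_ne : g ≠ 0
  right_ne : r ≠ 0
  two_left_ne : g + g ≠ 0
  two_right_ne : r + r ≠ 0
  sub_ne : g ≠ r
  add_ne : g + r ≠ 0
  two_add_ne : g + g + r + r ≠ 0

section

variable {W : Type*} [AddCommGroup W] {g r : W} {M : W → W}

/-- The vertex `v` is matched with the opposite vertex of the square at `v`. -/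
def Diag (g r : W) (M : W → W) (v : W) : Prop := M v = v + g + r

theorem Diag.add_left_add_right (h : IsCrossMatching g r M) {v : W} (hv : Diag g r M v) :
    ¬ Diag g r M (v + g + r) := by
  intro h'
  have h1 := h.invol v
  have h2 := h.two_add_ne
  unfold Diag at *
  rw [hv, h'] at h1
  grind

theorem Diag.not_up (h : IsCrossMatching g r M) {v : W} (hv : Diag g r M (v - g)) :
    ¬ Diag g r M (v + r) := by
  simpa using hv.add_left_add_right h

/-- The vertex `v` is the start of a diagonal of a square, and it has the role `a`. -/
def HasRole (g r : W) (M : W → W) (ρ : W → Role) (a : Role) (v : W) : Prop :=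
  Diag g r M v ∧ ρ v = a

/-- The role assignment `ρ` groups the diagonals into blocks. -/
structure IsRoleAssignment (g r : W) (M : W → W) (ρ : W → Role) : Prop where
  single : ∀ v, HasRole g r M ρ .single v → ¬ Diag g r M (v - g)
  pairFst : ∀ v, HasRole g r M ρ .pairFst v → HasRole g r M ρ .pairSnd (v - g)
  pairSnd : ∀ v, HasRole g r M ρ .pairSnd v → HasRole g r M ρ .pairFst (v + g)
  relay : ∀ v, HasRole g r M ρ .relay v → Diag g r M (v - r) ∧ (ρ (v - r)).Lends
  tripFst : ∀ v, HasRole g r M ρ .tripFst v → HasRole g r M ρ .tripSnd (v - g)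
  tripSnd : ∀ v, HasRole g r M ρ .tripSnd v → HasRole g r M ρ .tripFst (v + g)
  tripSnd' : ∀ v, HasRole g r M ρ .tripSnd v → HasRole g r M ρ .tripThd (v - g)
  tripThd : ∀ v, HasRole g r M ρ .tripThd v → HasRole g r M ρ .tripSnd (v + g)
  quadFst : ∀ v, HasRole g r M ρ .quadFst v → HasRole g r M ρ .quadSnd (v - g)
  quadSnd : ∀ v, HasRole g r M ρ .quadSnd v → HasRole g r M ρ .quadFst (v + g)
  quadSnd' : ∀ v, HasRole g r M ρ .quadSnd v → HasRole g r M ρ .quadThd (v + r)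
  quadThd : ∀ v, HasRole g r M ρ .quadThd v → HasRole g r M ρ .quadSnd (v - r)
  quadThd' : ∀ v, HasRole g r M ρ .quadThd v → HasRole g r M ρ .quadFth (v - g)
  quadFth : ∀ v, HasRole g r M ρ .quadFth v → HasRole g r M ρ .quadThd (v + g)
  row : ∀ v, HasRole g r M ρ .row v → HasRole g r M ρ .row (v - g)
  row' : ∀ v, HasRole g r M ρ .row v → HasRole g r M ρ .row (v + g)
  up : ∀ v, Diag g r M v → (ρ v).Lends → Diag g r M (v + r) → ρ (v + r) = .relay
  back : ∀ v, Diag g r M v → (ρ v).Lends → Diag g r M (v - g) → (ρ (v - g)).IsStart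

/-- The successor is injective: `u - g = v + r` would make `u` the far end of the diagonal at `v`.
By finiteness it extends to a permutation, whose arbitrary values occur only at `halt`. -/
theorem exists_step_perm [Finite W] (h : IsCrossMatching g r M) :
    ∃ (π : Equiv.Perm W) (L : W → Step),
      (∀ v, L v = .back → Diag g r M v ∧ Diag g r M (v - g) ∧ π v = v - g) ∧
      (∀ v, L v = .up → Diag g r M v ∧ Diag g r M (v + r) ∧ π v = v + r) ∧
      (∀ v, L v ≠ .back → Diag g r M v → ¬ Diag g r M (v - g)) ∧
      (∀ v, L v ≠ .up → Diag g r M v → Diag g r M (v - g) ∨ ¬ Diag g r M (v + r)) := by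
  classical
  let p : W → Prop := fun v => Diag g r M v ∧ (Diag g r M (v - g) ∨ Diag g r M (v + r))
  let f : {v // p v} → W := fun v => if Diag g r M (v - g) then v - g else v + r
  have hf : Function.Injective f := by
    rintro ⟨u, hu, hu'⟩ ⟨v, hv, hv'⟩ huv
    simp only [f, Subtype.mk.injEq] at huv ⊢
    have key : ∀ u v, Diag g r M u → Diag g r M v → u - g = v + r → False := by
      intro u v hu hv huv
      have := hv.add_left_add_right h
      rw [show v + g + r = u by grind] at this
      exact this hu
    split_ifs at huv with h1 h2 h2
    · simpa using huv
    · exact (key u v hu hv huv).elim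
    · exact (key v u hv hu huv.symm).elim
    · simpa using huv
  let π := (Equiv.ofInjective f hf).extendSubtype
  have hπ : ∀ v (hv : p v), π v = f ⟨v, hv⟩ := fun v hv => by
    simp only [π]
    rw [Equiv.extendSubtype_apply_of_mem _ _ hv]
    rfl
  refine ⟨π, fun v => if Diag g r M v ∧ Diag g r M (v - g) then .back
    else if Diag g r M v ∧ Diag g r M (v + r) then .up else .halt, ?_, ?_, ?_, ?_⟩
  · intro v hv
    dsimp only at hv
    split_ifs at hv with h1
    exact ⟨h1.1, h1.2, by rw [hπ v ⟨h1.1, .inl h1.2⟩]; simp [f, h1.2]⟩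
  · intro v hv
    dsimp only at hv
    split_ifs at hv with h1 h2
    have h3 : ¬ Diag g r M (v - g) := fun h' => h1 ⟨h2.1, h'⟩
    exact ⟨h2.1, h2.2, by rw [hπ v ⟨h2.1, .inr h2.2⟩]; simp [f, h3]⟩
  · intro v hv hd h'
    simp [hd, h'] at hv
  · intro v hv hd
    by_contra! hcon
    simp [hd, hcon] at hv

theorem exists_isRoleAssignment [Finite W] (h : IsCrossMatching g r M) :
    ∃ ρ : W → Role, IsRoleAssignment g r M ρ := by
  obtain ⟨π, L, hback, hup, hnback, hnup⟩ := exists_step_perm h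
  obtain ⟨ρ, hρ⟩ := π.exists_role L (by
    -- A 2-cycle `back, up` would give `v - g + r = v`, hence `g = r`.
    intro v hv h1 h2
    have h3 := (hback v h1).2.2
    have h4 := (hup _ h2).2.2
    have := h.sub_ne
    rw [hv, h3] at h4
    grind)
  have hnext : ∀ v, Role.Trans (ρ (π.symm v)) (L (π.symm v)) (ρ v) := fun v => by
    simpa using hρ (π.symm v)
  have prev_back : ∀ v, L (π.symm v) = .back → π.symm v = v + g ∧ Diag g r M (v + g) := by
    intro v hv
    obtain ⟨h1, -, h3⟩ := hback _ hv
    have h4 : π.symm v = v + g := by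
      rw [Equiv.apply_symm_apply] at h3; grind
    exact ⟨h4, h4 ▸ h1⟩
  have prev_up : ∀ v, L (π.symm v) = .up → π.symm v = v - r ∧ Diag g r M (v - r) := by
    intro v hv
    obtain ⟨h1, -, h3⟩ := hup _ hv
    have h4 : π.symm v = v - r := by
      rw [Equiv.apply_symm_apply] at h3; grind
    exact ⟨h4, h4 ▸ h1⟩
  have next_back : ∀ v a b, ρ v = a → (∀ l c, Role.Trans a l c → l = .back ∧ c = b) →
      HasRole g r M ρ b (v - g) := by
    intro v a b ha hab
    obtain ⟨h1, h2⟩ := hab _ _ (ha ▸ hρ v)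
    obtain ⟨-, h3, h4⟩ := hback v h1
    exact ⟨h3, h4 ▸ h2⟩
  have next_up : ∀ v a b, ρ v = a → (∀ l c, Role.Trans a l c → l = .up ∧ c = b) →
      HasRole g r M ρ b (v + r) := by
    intro v a b ha hab
    obtain ⟨h1, h2⟩ := hab _ _ (ha ▸ hρ v)
    obtain ⟨-, h3, h4⟩ := hup v h1
    exact ⟨h3, h4 ▸ h2⟩
  have pred_back : ∀ v a b, ρ v = b → (∀ l c, Role.Trans c l b → l = .back ∧ c = a) →
      HasRole g r M ρ a (v + g) := by
    intro v a b hb hab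
    obtain ⟨h1, h2⟩ := hab _ _ (hb ▸ hnext v)
    obtain ⟨h3, h4⟩ := prev_back v h1
    exact ⟨h4, h3 ▸ h2⟩
  have pred_up : ∀ v a b, ρ v = b → (∀ l c, Role.Trans c l b → l = .up ∧ c = a) →
      HasRole g r M ρ a (v - r) := by
    intro v a b hb hab
    obtain ⟨h1, h2⟩ := hab _ _ (hb ▸ hnext v)
    obtain ⟨h3, h4⟩ := prev_up v h1
    exact ⟨h4, h3 ▸ h2⟩
  refine ⟨ρ, ?_, ?_, ?_, ?_, ?_, ?_, ?_, ?_, ?_, ?_, ?_, ?_, ?_, ?_, ?_, ?_, ?_, ?_⟩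
  · rintro v ⟨hd, hv⟩
    have := hρ v
    rw [hv] at this
    exact hnback v this.1 hd
  · rintro v ⟨hd, hv⟩
    exact next_back v _ _ hv fun _ _ h => h
  · rintro v ⟨hd, hv⟩
    exact pred_back v _ _ hv fun _ _ h => h.of_pairSnd
  · rintro v ⟨hd, hv⟩
    have h1 := hnext v
    rw [hv] at h1
    have h2 := h1.of_relay
    obtain ⟨h3, h4⟩ := prev_up v h2.1
    exact ⟨h4, h3 ▸ h2.2⟩
  · rintro v ⟨hd, hv⟩
    exact next_back v _ _ hv fun _ _ h => h
  · rintro v ⟨hd, hv⟩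
    exact pred_back v _ _ hv fun _ _ h => h.of_tripSnd
  · rintro v ⟨hd, hv⟩
    exact next_back v _ _ hv fun _ _ h => h
  · rintro v ⟨hd, hv⟩
    exact pred_back v _ _ hv fun _ _ h => h.of_tripThd
  · rintro v ⟨hd, hv⟩
    exact next_back v _ _ hv fun _ _ h => h
  · rintro v ⟨hd, hv⟩
    exact pred_back v _ _ hv fun _ _ h => h.of_quadSnd
  · rintro v ⟨hd, hv⟩
    exact next_up v _ _ hv fun _ _ h => h
  · rintro v ⟨hd, hv⟩
    exact pred_up v _ _ hv fun _ _ h => h.of_quadThd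
  · rintro v ⟨hd, hv⟩
    exact next_back v _ _ hv fun _ _ h => h
  · rintro v ⟨hd, hv⟩
    exact pred_back v _ _ hv fun _ _ h => h.of_quadFth
  · rintro v ⟨hd, hv⟩
    exact next_back v _ _ hv fun _ _ h => h
  · rintro v ⟨hd, hv⟩
    exact pred_back v _ _ hv fun _ _ h => h.of_row
  · intro v hd hl hu
    have h1 := hρ v
    have h2 : ¬ Diag g r M (v - g) := fun h' => h'.not_up h hu
    have h3 : L v = .up := by
      by_contra h'
      exact (hnup v h' hd).elim h2 fun h' => h' hu
    obtain ⟨-, -, h4⟩ := hup v h3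
    rw [h3, h4] at h1
    exact hl.trans_up h1
  · intro v hd hl hb
    have h1 := hρ v
    have h3 : L v = .back := by
      by_contra h'
      exact hnback v h' hd hb
    obtain ⟨-, -, h4⟩ := hback v h3
    rw [h3, h4] at h1
    exact hl.trans_back h1

end

/-! ### Trails, routes and their injectivity -/

section

variable {W : Type*} [AddCommGroup W] {g r : W} {M : W → W} {ρ : W → Role}

theorem Role.IsStart.cases {v : W} (hv : (ρ v).IsStart) (hd : Diag g r M v) :
    HasRole g r M ρ .single v ∨ HasRole g r M ρ .pairFst v ∨ HasRole g r M ρ .tripFst v ∨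
      HasRole g r M ρ .quadFst v := by
  rcases hv with h | h | h | h <;> simp [HasRole, hd, h]

/-- The vertex `x` precedes a diagonal of role `single`. -/
def Gap (g r : W) (M : W → W) (ρ : W → Role) (x : W) : Prop := HasRole g r M ρ .single (x + g)

/-- The vertex `x` lies above a diagonal that hands a trail over to it. -/
def Lent (g r : W) (M : W → W) (ρ : W → Role) (x : W) : Prop :=
  Diag g r M (x - r) ∧ (ρ (x - r)).Lends

open Classical in
/-- The end of the trail of length two that starts at `x` and continues through `x + g`. -/
noncomputable def tailEnd (g r : W) (M : W → W) (ρ : W → Role) (x : W) : W :=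
  if Gap g r M ρ x then x + g + g + r else if Lent g r M ρ x then x + g + g else x + g + r

/-- Adjacency in the union of the graph generated by `g` and `r` with the matching `M`. -/
def CrossAdj (g r : W) (M : W → W) (u v : W) : Prop :=
  v = u + g ∨ v = u - g ∨ v = u + r ∨ v = u - r ∨ M u = v

/-- The tuple `p` lists the vertices of a path of length five. -/
def IsRoute (g r : W) (M : W → W) (p : Fin 6 → W) : Prop :=
  Function.Injective p ∧ ∀ i : Fin 5, CrossAdj g r M (p i.castSucc) (p i.succ)

theorem isRoute_vec {a b c d e f : W} (hab : a ≠ b) (hac : a ≠ c) (had : a ≠ d) (hae : a ≠ e)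
    (haf : a ≠ f) (hbc : b ≠ c) (hbd : b ≠ d) (hbe : b ≠ e) (hbf : b ≠ f) (hcd : c ≠ d)
    (hce : c ≠ e) (hcf : c ≠ f) (hde : d ≠ e) (hdf : d ≠ f) (hef : e ≠ f)
    (h1 : CrossAdj g r M a b) (h2 : CrossAdj g r M b c) (h3 : CrossAdj g r M c d)
    (h4 : CrossAdj g r M d e) (h5 : CrossAdj g r M e f) :
    IsRoute g r M ![a, b, c, d, e, f] := by
  refine ⟨fun i j hij => ?_, fun i => ?_⟩
  · fin_cases i <;> fin_cases j <;> simp_all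
  · fin_cases i <;> simpa

theorem tailEnd_cases (x : W) :
    (Gap g r M ρ x ∧ tailEnd g r M ρ x = x + g + g + r) ∨
    (¬ Gap g r M ρ x ∧ Lent g r M ρ x ∧ tailEnd g r M ρ x = x + g + g) ∨
    (¬ Gap g r M ρ x ∧ ¬ Lent g r M ρ x ∧ tailEnd g r M ρ x = x + g + r) := by
  unfold tailEnd
  split_ifs <;> simp_all

theorem crossAdj_tailEnd (x : W) : CrossAdj g r M (x + g) (tailEnd g r M ρ x) := by
  rcases tailEnd_cases (g := g) (r := r) (M := M) (ρ := ρ) x with ⟨h, h'⟩ | ⟨-, -, h⟩ | ⟨-, -, h⟩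
  · have := h.1
    unfold Diag at this
    simp [CrossAdj, h', this]
  · simp [CrossAdj, h]
  · simp [CrossAdj, h]

theorem IsCrossMatching.symm_adj (h : IsCrossMatching g r M) {u v : W}
    (huv : CrossAdj g r M u v) : CrossAdj g r M v u := by
  have := h.invol u
  unfold CrossAdj at *
  grind

theorem IsCrossMatching.diag_ne (h : IsCrossMatching g r M) {v : W} (hv : Diag g r M v) :
    g + g + r ≠ 0 ∧ g + r + r ≠ 0 := by
  have h1 := h.ne_sub_left v
  have h2 := h.ne_sub_right v
  unfold Diag at hv
  grind

theorem Lent.diag (hρ : IsRoleAssignment g r M ρ) {x : W} (hx : Lent g r M ρ x) :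
    Diag g r M (x - r) ∧ Diag g r M (x - r + g) ∧
      (ρ (x - r + g) = .pairFst ∨ ρ (x - r + g) = .quadThd) := by
  obtain ⟨h1, h2 | h2⟩ := hx
  · exact ⟨h1, (hρ.pairSnd _ ⟨h1, h2⟩).1, .inl (hρ.pairSnd _ ⟨h1, h2⟩).2⟩
  · exact ⟨h1, (hρ.quadFth _ ⟨h1, h2⟩).1, .inr (hρ.quadFth _ ⟨h1, h2⟩).2⟩

/-- A block whose first element is `v` has no further block behind it, unless it contains
`v - g`. -/
theorem Role.IsStart.role_sub (hρ : IsRoleAssignment g r M ρ) {v : W} (hd : Diag g r M v)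
    (hv : (ρ v).IsStart) (hb : Diag g r M (v - g)) :
    ρ (v - g) = .pairSnd ∨ ρ (v - g) = .tripSnd ∨ ρ (v - g) = .quadSnd := by
  rcases hv.cases hd with h1 | h1 | h1 | h1
  · exact absurd hb (hρ.single v h1)
  · exact .inl (hρ.pairFst v h1).2
  · exact .inr (.inl (hρ.tripFst v h1).2)
  · exact .inr (.inr (hρ.quadFst v h1).2)

/-- A collision by wrapping around (`3g = 0` or `3g + r = 0`) would either give `v - g` a role that
its block forbids, or make `v` the far end of another diagonal. -/
theorem tailEnd_ne_of_isStart (h : IsCrossMatching g r M) (hρ : IsRoleAssignment g r M ρ)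
    (h32 : g + g + g + r + r ≠ 0) {v : W} (hd : Diag g r M v) (hv : (ρ v).IsStart) :
    tailEnd g r M ρ (v + g + r) ≠ v + r ∧ tailEnd g r M ρ (v + g + r) ≠ v ∧
      tailEnd g r M ρ (v + g + r) ≠ v + g ∧ tailEnd g r M ρ (v + g + r) ≠ v + g + r ∧
      tailEnd g r M ρ (v + g + r) ≠ v + g + r + g := by
  obtain ⟨h21, h12⟩ := h.diag_ne hd
  have a1 := h.left_ne
  have a2 := h.right_ne
  have a3 := h.two_left_ne
  have a4 := h.two_right_ne
  have a5 := h.sub_ne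
  have a6 := h.add_ne
  have a7 := h.two_add_ne
  rcases tailEnd_cases (g := g) (r := r) (M := M) (ρ := ρ) (v + g + r) with
    ⟨h1, h2⟩ | ⟨-, h1, h2⟩ | ⟨-, -, h2⟩
  · have h3 : g + g + g + r ≠ 0 := by
      intro h3
      obtain ⟨h4, h5⟩ := h1
      have h6 : v + g + r + g = v - g := by grind
      rw [h6] at h4 h5
      rcases hv.role_sub hρ hd h4 with h7 | h7 | h7 <;> rw [h5] at h7 <;> cases h7
    rw [h2]
    grind
  · obtain ⟨h3, h4, h5⟩ := h1.diag hρ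
    have e1 : v + g + r - r = v + g := by grind
    have e2 : v + g + r - r + g = v + g + g := by grind
    rw [e2] at h4 h5
    rw [e1] at h3
    have h6 : g + g + g + r ≠ 0 := by
      intro h6
      refine h4.add_left_add_right h ?_
      rwa [show v + g + g + g + r = v by grind]
    have h7 : g + g + g ≠ 0 := by
      intro h7
      have e3 : v + g + g = v - g := by grind
      rw [e3] at h4 h5
      have h8 := hv.role_sub hρ hd h4
      rcases h5 with h5 | h5 <;> rw [h5] at h8 <;> simp at h8
    rw [h2]
    grind
  · rw [h2]
    grind

/-- The path of the diagonal at `v` when `v` has the role `a`. -/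
noncomputable def route (g r : W) (M : W → W) (ρ : W → Role) (a : Role) (v : W) : Fin 6 → W :=
  open Classical in
  match a with
  | .single | .pairFst | .tripFst | .quadFst =>
    ![v + r, v, v + g, v + g + r, v + g + r + g, tailEnd g r M ρ (v + g + r)]
  | .pairSnd | .quadFth =>
    ![v + g + r + r, v + g + r, v, v + g, v + g + r + g, v + g + r + g + r]
  | .relay =>
    ![tailEnd g r M ρ v, v + g, v, M v, M v + g, tailEnd g r M ρ (M v)]
  | .tripSnd =>
    ![v + r, v - g, v, v + g + r, v + g + r + g, tailEnd g r M ρ (v + g + r)]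
  | .tripThd =>
    ![v + g + r + g + g, v + g + g, v + g, v + g + r, v + g + r + g,
      tailEnd g r M ρ (v + g + r)]
  | .quadSnd =>
    ![v + g + r + g, v + g, v, v + g + r, v + g + r + r, v + g + r + g + r]
  | .quadThd =>
    ![v + r, v, v + g, v + g + g, v + g + g + r,
      if Gap g r M ρ (v + g + r) then v + g + g + r + g + r else v + g + g + r + r]
  | .row => ![v - g + r, v - g, v, v + g + r, v + r, v + r + r]

/-- The first member of a block gives its diagonal away and takes the edge from `v` to `v + r`. For
`single` the diagonal goes to the trail of `v - g`, otherwise to a later member of the block. -/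
theorem isRoute_start (h : IsCrossMatching g r M) (hρ : IsRoleAssignment g r M ρ)
    (h32 : g + g + g + r + r ≠ 0) {v : W} (hd : Diag g r M v) (hv : (ρ v).IsStart) :
    IsRoute g r M ![v + r, v, v + g, v + g + r, v + g + r + g, tailEnd g r M ρ (v + g + r)] := by
  obtain ⟨h21, h12⟩ := h.diag_ne hd
  obtain ⟨t1, t2, t3, t4, t5⟩ := tailEnd_ne_of_isStart h hρ h32 hd hv
  have a1 := h.left_ne
  have a2 := h.right_ne
  have a3 := h.two_left_ne
  have a5 := h.sub_ne
  have a6 := h.add_ne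
  refine isRoute_vec ?_ ?_ ?_ ?_ t1.symm ?_ ?_ ?_ t2.symm ?_ ?_ t3.symm ?_ t4.symm t5.symm
    ?_ ?_ ?_ ?_ (crossAdj_tailEnd _)
  all_goals first | grind | (unfold CrossAdj; grind)

/-- This path carries the diagonals at `v` and at `v + g`. It trades the `g`-edge at `v + g + r` for
the `r`-edge there, which straightens the trail of `v + r`. -/
theorem isRoute_lends (h : IsCrossMatching g r M) {v : W} (hd : Diag g r M v)
    (hd' : Diag g r M (v + g)) :
    IsRoute g r M ![v + g + r + r, v + g + r, v, v + g, v + g + r + g, v + g + r + g + r] := by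
  obtain ⟨h21, h12⟩ := h.diag_ne hd
  have a1 := h.left_ne
  have a2 := h.right_ne
  have a3 := h.two_left_ne
  have a4 := h.two_right_ne
  have a5 := h.sub_ne
  have a6 := h.add_ne
  have a7 := h.two_add_ne
  have hM := h.invol v
  unfold Diag at hd hd'
  apply isRoute_vec
  all_goals first | grind | (unfold CrossAdj; grind)

theorem isRoute_quadSnd (h : IsCrossMatching g r M) {v : W} (hd : Diag g r M v)
    (hd' : Diag g r M (v + g)) :
    IsRoute g r M
      ![v + g + r + g, v + g, v, v + g + r, v + g + r + r, v + g + r + g + r] := by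
  obtain ⟨h21, h12⟩ := h.diag_ne hd
  have a1 := h.left_ne
  have a2 := h.right_ne
  have a3 := h.two_left_ne
  have a4 := h.two_right_ne
  have a5 := h.sub_ne
  have a6 := h.add_ne
  have a7 := h.two_add_ne
  have hM := h.invol (v + g)
  unfold Diag at hd hd'
  apply isRoute_vec
  all_goals first | grind | (unfold CrossAdj; grind)

/-- If the whole orbit of `v` under translation by `g` consists of diagonals, all paths borrow edges
from one another by the same shift, so none is lost. -/
theorem isRoute_row (h : IsCrossMatching g r M) {v : W} (hd : Diag g r M v) :
    IsRoute g r M ![v - g + r, v - g, v, v + g + r, v + r, v + r + r] := by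
  obtain ⟨h21, h12⟩ := h.diag_ne hd
  have a1 := h.left_ne
  have a2 := h.right_ne
  have a3 := h.two_left_ne
  have a4 := h.two_right_ne
  have a5 := h.sub_ne
  have a6 := h.add_ne
  unfold Diag at hd
  apply isRoute_vec
  all_goals first | grind | (unfold CrossAdj; grind)

/-- A gap would need a diagonal at `v + g + g + r`, the far end of the one at `v + g`; lending would
have to come from `v + g`. -/
theorem tailEnd_trip (h : IsCrossMatching g r M) {v : W}
    (hd : Diag g r M (v + g)) (hv : ¬ (ρ (v + g)).Lends) :
    tailEnd g r M ρ (v + g + r) = v + g + r + g + r := by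
  rcases tailEnd_cases (g := g) (r := r) (M := M) (ρ := ρ) (v + g + r) with
    ⟨h1, h2⟩ | ⟨-, h1, h2⟩ | ⟨-, -, h2⟩
  · refine absurd h1.1 ?_
    have := hd.add_left_add_right h
    rwa [show v + g + g + r = v + g + r + g by grind] at this
  · refine absurd h1.2 ?_
    rwa [show v + g + r - r = v + g by grind]
  · exact h2

/-- In a triple the second path carries its own diagonal and the third one's; the third path carries
the first one's. -/
theorem isRoute_tripSnd (h : IsCrossMatching g r M) (hρ : IsRoleAssignment g r M ρ)
    (h32 : g + g + g + r + r ≠ 0) {v : W} (hv : HasRole g r M ρ .tripSnd v) :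
    IsRoute g r M
      ![v + r, v - g, v, v + g + r, v + g + r + g, tailEnd g r M ρ (v + g + r)] := by
  have hd := hv.1
  have h1 := hρ.tripSnd v hv
  have h2 := (hρ.tripSnd' v hv).1
  rw [tailEnd_trip h h1.1 (by rw [h1.2]; simp [Role.Lends])]
  have h3 : g + g + g + r ≠ 0 := by
    intro h3
    refine h1.1.add_left_add_right h ?_
    rwa [show v + g + g + r = v - g by grind]
  obtain ⟨h21, h12⟩ := h.diag_ne hd
  have a1 := h.left_ne
  have a2 := h.right_ne
  have a3 := h.two_left_ne
  have a4 := h.two_right_ne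
  have a5 := h.sub_ne
  have a6 := h.add_ne
  have a7 := h.two_add_ne
  have hM := h.invol (v - g)
  unfold Diag at hd h2
  rw [h2, show v - g + g + r = v + r by grind] at hM
  apply isRoute_vec
  all_goals first | grind | (unfold CrossAdj; grind)

theorem isRoute_tripThd (h : IsCrossMatching g r M) (hρ : IsRoleAssignment g r M ρ)
    {v : W} (hv : HasRole g r M ρ .tripThd v) :
    IsRoute g r M
      ![v + g + r + g + g, v + g + g, v + g, v + g + r, v + g + r + g,
        tailEnd g r M ρ (v + g + r)] := by
  have hd := hv.1
  have h1 := hρ.tripThd v hv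
  have h2 := (hρ.tripSnd _ h1).1
  rw [tailEnd_trip h h1.1 (by rw [h1.2]; simp [Role.Lends])]
  obtain ⟨h21, h12⟩ := h.diag_ne hd
  have a1 := h.left_ne
  have a2 := h.right_ne
  have a3 := h.two_left_ne
  have a4 := h.two_right_ne
  have a5 := h.sub_ne
  have a6 := h.add_ne
  have a7 := h.two_add_ne
  have hM := h.invol (v + g + g)
  unfold Diag at hd h2
  apply isRoute_vec
  all_goals first | grind | (unfold CrossAdj; grind)

/-- The path takes over the trail at the far end of the `quadSnd` diagonal and the last edge of the
trail at its own far end. The latter may be altered by a gap but not by lending, since `v + g` is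
the far end of the diagonal at `v - r`. -/
theorem isRoute_quadThd (h : IsCrossMatching g r M) (hρ : IsRoleAssignment g r M ρ)
    (h32 : g + g + g + r + r ≠ 0) {v : W} (hv : HasRole g r M ρ .quadThd v) :
    IsRoute g r M (route g r M ρ .quadThd v) := by
  have hd := hv.1
  have h1 := hρ.quadThd v hv
  have h2 := hρ.quadSnd _ h1
  have h3 := hρ.quadThd' v hv
  obtain ⟨h21, h12⟩ := h.diag_ne hd
  have a1 := h.left_ne
  have a2 := h.right_ne
  have a3 := h.two_left_ne
  have a4 := h.two_right_ne
  have a5 := h.sub_ne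
  have a6 := h.add_ne
  have a7 := h.two_add_ne
  have a8 : g + g ≠ r := by
    intro h4
    rw [show v - r + g = v - g by grind] at h2
    have := h2.2.symm.trans h3.2
    cases this
  unfold route
  dsimp only
  split_ifs with hg
  · have a9 : g + g + g + r ≠ 0 := by
      intro h4
      obtain ⟨-, h5⟩ := hg
      rw [show v + g + r + g = v - g by grind] at h5
      have := h5.symm.trans h3.2
      cases this
    have h6 := hg.1
    unfold Diag at hd h6
    apply isRoute_vec
    all_goals first | grind | (unfold CrossAdj; grind)
  · apply isRoute_vec
    all_goals first | grind | (unfold CrossAdj; grind)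

/-- Because `v` has been lent an edge, its trail runs straight to `v + g + g` instead of closing up
at `M v`. -/
theorem isRoute_relay (h : IsCrossMatching g r M) (hρ : IsRoleAssignment g r M ρ)
    (h32 : g + g + g + r + r ≠ 0) {v : W} (hv : HasRole g r M ρ .relay v) :
    IsRoute g r M ![tailEnd g r M ρ v, v + g, v, M v, M v + g, tailEnd g r M ρ (M v)] := by
  have hd := hv.1
  have hl : Lent g r M ρ v := hρ.relay v hv
  obtain ⟨h21, h12⟩ := h.diag_ne hd
  have a1 := h.left_ne
  have a2 := h.right_ne
  have a3 := h.two_left_ne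
  have a4 := h.two_right_ne
  have a5 := h.sub_ne
  have a6 := h.add_ne
  have a7 := h.two_add_ne
  have c1 := crossAdj_tailEnd (g := g) (r := r) (M := M) (ρ := ρ) v
  have c2 := crossAdj_tailEnd (g := g) (r := r) (M := M) (ρ := ρ) (M v)
  have e1 : tailEnd g r M ρ v = v + g + g := by
    rcases tailEnd_cases (g := g) (r := r) (M := M) (ρ := ρ) v with
      ⟨h1, -⟩ | ⟨-, -, h1⟩ | ⟨-, h1, -⟩
    · have := hρ.single _ h1
      rw [add_sub_cancel_right] at this
      exact absurd hd this
    · exact h1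
    · exact absurd hl h1
  have hdM : M v = v + g + r := hd
  rw [e1] at c1 ⊢
  rw [hdM] at c2 ⊢
  have c1' := h.symm_adj c1
  rcases tailEnd_cases (g := g) (r := r) (M := M) (ρ := ρ) (v + g + r) with
    ⟨-, h2⟩ | ⟨-, h1, -⟩ | ⟨-, -, h2⟩
  · rw [h2] at c2 ⊢
    refine isRoute_vec ?_ ?_ ?_ ?_ ?_ ?_ ?_ ?_ ?_ ?_ ?_ ?_ ?_ ?_ ?_ c1' ?_ ?_ ?_ c2
    all_goals first | grind | (unfold CrossAdj; grind)
  · have h3 := h1.1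
    have h4 := hl.1.add_left_add_right h
    rw [show v - r + g + r = v + g by grind] at h4
    rw [show v + g + r - r = v + g by grind] at h3
    exact absurd h3 h4
  · rw [h2] at c2 ⊢
    refine isRoute_vec ?_ ?_ ?_ ?_ ?_ ?_ ?_ ?_ ?_ ?_ ?_ ?_ ?_ ?_ ?_ c1' ?_ ?_ ?_ c2
    all_goals first | grind | (unfold CrossAdj; grind)

/-- A trail is altered only near a diagonal at `v + g` or `v - r + g`. The ends of that diagonal are
already matched, so `M v` avoids them. -/
theorem tailEnd_cases_of_not_diag (h : IsCrossMatching g r M) (hρ : IsRoleAssignment g r M ρ)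
    (v : W) :
    (tailEnd g r M ρ v = v + g + g + r ∧ M v ≠ v + g + g + r ∧ g + g + r ≠ 0) ∨
    (tailEnd g r M ρ v = v + g + g ∧ M v ≠ v + g + g ∧ M v ≠ v + g - r ∧ g + g + r ≠ 0) ∨
    tailEnd g r M ρ v = v + g + r := by
  have a1 := h.left_ne
  have a3 := h.two_left_ne
  have a5 := h.sub_ne
  have i1 := h.invol v
  rcases tailEnd_cases (g := g) (r := r) (M := M) (ρ := ρ) v with
    ⟨h1, h2⟩ | ⟨-, h1, h2⟩ | ⟨-, -, h2⟩
  · have h3 : M (v + g) = v + g + g + r := h1.1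
    have i2 := h.invol (v + g)
    refine .inl ⟨h2, fun h4 => ?_, (h.diag_ne h1.1).1⟩
    rw [h4] at i1
    rw [h3] at i2
    grind
  · obtain ⟨h3, h4, -⟩ := h1.diag hρ
    have i2 := h.invol (v - r + g)
    refine .inr (.inl ⟨h2, fun h5 => ?_, fun h5 => ?_, (h.diag_ne h3).1⟩)
    · unfold Diag at h4
      rw [h4] at i2
      rw [h5] at i1
      have : v + g + g = v - r + g + g + r := by grind
      rw [this] at i1
      grind
    · unfold Diag at h4
      rw [show v - r + g = M v by grind, i1] at h4
      grind
  · exact .inr (.inr h2)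

theorem isRoute_pair (h : IsCrossMatching g r M) (hρ : IsRoleAssignment g r M ρ) {v : W}
    (hv : ¬ Diag g r M v) (hv' : ¬ Diag g r M (M v)) :
    IsRoute g r M ![tailEnd g r M ρ v, v + g, v, M v, M v + g, tailEnd g r M ρ (M v)] := by
  have a1 := h.left_ne
  have a2 := h.right_ne
  have a3 := h.two_left_ne
  have a4 := h.two_right_ne
  have a5 := h.sub_ne
  have a6 := h.add_ne
  have b0 := h.ne_self v
  have b1 := h.ne_add_left v
  have b2 := h.ne_sub_left v
  have b3 := h.ne_add_right v
  have b4 := h.ne_sub_right v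
  have c1 := h.symm_adj (crossAdj_tailEnd (g := g) (r := r) (M := M) (ρ := ρ) v)
  have c2 := crossAdj_tailEnd (g := g) (r := r) (M := M) (ρ := ρ) (M v)
  have t1 := tailEnd_cases_of_not_diag h hρ v
  have t2 := tailEnd_cases_of_not_diag h hρ (M v)
  unfold Diag at hv hv'
  rw [h.invol] at hv' t2
  have c3 : CrossAdj g r M v (M v) := by simp [CrossAdj]
  generalize tailEnd g r M ρ v = x at *
  generalize tailEnd g r M ρ (M v) = y at *
  generalize M v = w at *
  refine isRoute_vec ?_ ?_ ?_ ?_ ?_ ?_ ?_ ?_ ?_ ?_ ?_ ?_ ?_ ?_ ?_ c1 (by simp [CrossAdj]) c3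
    (by simp [CrossAdj]) c2
  all_goals
    rcases t1 with t1 | t1 | t1 <;> rcases t2 with t2 | t2 | t2 <;> grind

theorem isRoute_route (h : IsCrossMatching g r M) (hρ : IsRoleAssignment g r M ρ)
    (h32 : g + g + g + r + r ≠ 0) {v : W} (hd : Diag g r M v) :
    IsRoute g r M (route g r M ρ (ρ v) v) := by
  cases ha : ρ v with
  | single => exact isRoute_start h hρ h32 hd (by simp [ha, Role.IsStart])
  | pairFst => exact isRoute_start h hρ h32 hd (by simp [ha, Role.IsStart])
  | tripFst => exact isRoute_start h hρ h32 hd (by simp [ha, Role.IsStart])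
  | quadFst => exact isRoute_start h hρ h32 hd (by simp [ha, Role.IsStart])
  | pairSnd => exact isRoute_lends h hd (hρ.pairSnd v ⟨hd, ha⟩).1
  | quadFth => exact isRoute_lends h hd (hρ.quadFth v ⟨hd, ha⟩).1
  | relay => exact isRoute_relay h hρ h32 ⟨hd, ha⟩
  | tripSnd => exact isRoute_tripSnd h hρ h32 ⟨hd, ha⟩
  | tripThd => exact isRoute_tripThd h hρ ⟨hd, ha⟩
  | quadSnd => exact isRoute_quadSnd h hd (hρ.quadSnd v ⟨hd, ha⟩).1
  | quadThd => exact isRoute_quadThd h hρ h32 ⟨hd, ha⟩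
  | row => exact isRoute_row h hd

end

/-! ### Every edge is covered -/

/-- The vertices `u` and `v` are consecutive in the tuple `p`. -/
def Covers {W : Type*} (p : Fin 6 → W) (u v : W) : Prop :=
  ∃ i : Fin 5, s(p i.castSucc, p i.succ) = s(u, v)

theorem covers_vec {W : Type*} {a b c d e f u v : W} :
    Covers ![a, b, c, d, e, f] u v ↔
      s(a, b) = s(u, v) ∨ s(b, c) = s(u, v) ∨ s(c, d) = s(u, v) ∨ s(d, e) = s(u, v) ∨
        s(e, f) = s(u, v) := by
  simp [Covers, Fin.exists_fin_succ]

theorem Covers.symm {W : Type*} {p : Fin 6 → W} {u v : W} (h : Covers p u v) : Covers p v u := by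
  obtain ⟨i, hi⟩ := h
  exact ⟨i, hi.trans Sym2.eq_swap⟩

section

variable {W : Type*} [AddCommGroup W] {g r : W} {M : W → W} {ρ : W → Role} {T : Set W}

open Classical in
/-- The path indexed by `v`. -/
noncomputable def routeAt (g r : W) (M : W → W) (ρ : W → Role) (v : W) : Fin 6 → W :=
  if Diag g r M v then route g r M ρ (ρ v) v else route g r M ρ .relay v

/-- The edge `uv` lies on one of the paths indexed by `T`. -/
def Covered (g r : W) (M : W → W) (ρ : W → Role) (T : Set W) (u v : W) : Prop :=
  ∃ p ∈ routeAt g r M ρ '' T, Covers p u v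

theorem Covered.symm {u v : W} (h : Covered g r M ρ T u v) : Covered g r M ρ T v u := by
  obtain ⟨p, hp, h⟩ := h
  exact ⟨p, hp, h.symm⟩

theorem HasRole.covered (hT : ∀ v, Diag g r M v → v ∈ T) {a : Role} {v : W}
    (hv : HasRole g r M ρ a v) {u w : W} (hc : Covers (route g r M ρ a v) u w) :
    Covered g r M ρ T u w :=
  ⟨_, ⟨v, hT v hv.1, rfl⟩, by rwa [routeAt, if_pos hv.1, hv.2]⟩

theorem covers_relay {v u w : W}
    (hc : s(tailEnd g r M ρ v, v + g) = s(u, w) ∨ s(v + g, v) = s(u, w) ∨ s(v, M v) = s(u, w) ∨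
      s(M v, M v + g) = s(u, w) ∨ s(M v + g, tailEnd g r M ρ (M v)) = s(u, w)) :
    Covers (route g r M ρ .relay v) u w :=
  covers_vec.2 hc

/-- Roles of diagonals whose path continues along the trail at the end of the diagonal. -/
def Role.KeepsTail (a : Role) : Prop :=
  a.IsStart ∨ a = relay ∨ a = tripSnd ∨ a = tripThd

theorem Role.keepsTail_or (a : Role) :
    a.KeepsTail ∨ a.Lends ∨ a = quadSnd ∨ a = quadThd ∨ a = row := by
  cases a <;> simp [KeepsTail, IsStart, Lends]

/-- The trail at `x` lies on the path of the matching edge at `x`; if `x` is the far end of a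
diagonal, this requires a role that leaves the far trail in place. -/
theorem tail_covered (h : IsCrossMatching g r M) (hT : ∀ v, Diag g r M v → v ∈ T)
    (hT' : ∀ v, v ∈ T ∨ M v ∈ T) {x : W} (hx : ¬ Diag g r M x)
    (hk : Diag g r M (x - g - r) → (ρ (x - g - r)).KeepsTail) :
    Covered g r M ρ T x (x + g) ∧ Covered g r M ρ T (x + g) (tailEnd g r M ρ x) := by
  by_cases hMx : Diag g r M (M x)
  · have hb : M x = x - g - r := by
      have h1 := h.invol x
      unfold Diag at hMx
      grind
    rw [hb] at hMx
    have hxe : x = x - g - r + g + r := by grind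
    have hk := hk hMx
    generalize x - g - r = b at *
    subst hxe
    have hM : M b = b + g + r := hMx
    have key : ∀ a, ρ b = a → a.KeepsTail →
        Covers (route g r M ρ a b) (b + g + r) (b + g + r + g) ∧
        Covers (route g r M ρ a b) (b + g + r + g) (tailEnd g r M ρ (b + g + r)) := by
      intro a _ ha
      cases a <;> simp [Role.KeepsTail, Role.IsStart] at ha <;>
        simp only [route, covers_vec, hM] <;> simp
    obtain ⟨k1, k2⟩ := key _ rfl hk
    exact ⟨HasRole.covered hT ⟨hMx, rfl⟩ k1, HasRole.covered hT ⟨hMx, rfl⟩ k2⟩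
  · rcases hT' x with hxT | hxT
    · refine ⟨⟨_, ⟨x, hxT, rfl⟩, ?_⟩, ⟨_, ⟨x, hxT, rfl⟩, ?_⟩⟩ <;>
        rw [routeAt, if_neg hx] <;> apply covers_relay <;> simp
    · refine ⟨⟨_, ⟨M x, hxT, rfl⟩, ?_⟩, ⟨_, ⟨M x, hxT, rfl⟩, ?_⟩⟩ <;>
        rw [routeAt, if_neg hMx] <;> apply covers_relay <;> simp [h.invol]

/-- A diagonal at `y` is a relay. Otherwise `y` may be the far end of the diagonal at `y - r - g`,
which begins a new block and so keeps its far trail. -/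
theorem lent_covered (h : IsCrossMatching g r M) (hρ : IsRoleAssignment g r M ρ)
    (hT : ∀ v, Diag g r M v → v ∈ T) (hT' : ∀ v, v ∈ T ∨ M v ∈ T) {y : W}
    (hy : Lent g r M ρ y) :
    Covered g r M ρ T y (y + g) ∧ Covered g r M ρ T (y + g) (y + g + g) := by
  have hgap : ¬ Gap g r M ρ y := fun hg => by
    have := hy.1.add_left_add_right h
    rw [show y - r + g + r = y + g by grind] at this
    exact this hg.1
  have htail : tailEnd g r M ρ y = y + g + g := by simp [tailEnd, hgap, hy]
  rw [← htail]
  by_cases hd : Diag g r M y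
  · have hrel : HasRole g r M ρ .relay y := by
      refine ⟨hd, ?_⟩
      have := hρ.up _ hy.1 hy.2
      rw [sub_add_cancel] at this
      exact this hd
    exact ⟨hrel.covered hT (covers_relay (by simp)), hrel.covered hT (covers_relay (by simp))⟩
  · refine tail_covered h hT hT' hd fun h1 => .inl ?_
    have := hρ.back _ hy.1 hy.2
    rw [sub_right_comm] at h1 ⊢
    exact this h1

theorem covered_left (h : IsCrossMatching g r M) (hρ : IsRoleAssignment g r M ρ)
    (hT : ∀ v, Diag g r M v → v ∈ T) (hT' : ∀ v, v ∈ T ∨ M v ∈ T) (x : W) :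
    Covered g r M ρ T x (x + g) := by
  by_cases hd : Diag g r M x
  · cases ha : ρ x
    case relay => exact HasRole.covered hT ⟨hd, ha⟩ (covers_relay (by simp))
    case tripSnd =>
      exact (hρ.tripSnd' x ⟨hd, ha⟩).covered hT (covers_vec.2 (by simp))
    case tripThd =>
      exact (hρ.tripThd x ⟨hd, ha⟩).covered hT (covers_vec.2 (by simp))
    case row =>
      exact (hρ.row' x ⟨hd, ha⟩).covered hT (covers_vec.2 (by simp))
    all_goals exact HasRole.covered hT ⟨hd, ha⟩ (covers_vec.2 (by simp))
  · by_cases hb : Diag g r M (x - g - r)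
    swap
    · exact (tail_covered h hT hT' hd fun h' => absurd h' hb).1
    rcases (ρ (x - g - r)).keepsTail_or with hk | hk | hk | hk | hk
    · exact (tail_covered h hT hT' hd fun _ => hk).1
    -- The straightened trail of `x - g` ends with the edge from `x` to `x + g`.
    · have hl : Lent g r M ρ (x - g) := ⟨hb, hk⟩
      simpa using (lent_covered h hρ hT hT' hl).2
    · refine (hρ.quadSnd' _ ⟨hb, hk⟩).covered hT (covers_vec.2 ?_)
      simp
    · refine (hρ.quadThd _ ⟨hb, hk⟩).covered hT (covers_vec.2 ?_)
      right; right; right; right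
      congr 1 <;> grind
    · refine (hρ.row' _ ⟨hb, hk⟩).covered hT (covers_vec.2 ?_)
      right; right; right; left
      rw [Sym2.eq_swap]
      congr 1 <;> grind

theorem covered_right_of_lends (hT : ∀ v, Diag g r M v → v ∈ T) {v : W}
    (hd : Diag g r M v) (hl : (ρ v).Lends) :
    Covered g r M ρ T (v + g + r + r) (v + g + r) ∧
      Covered g r M ρ T (v + g + r + g) (v + g + r + g + r) := by
  rcases hl with ha | ha <;>
    exact ⟨HasRole.covered hT ⟨hd, ha⟩ (covers_vec.2 (by simp)),
      HasRole.covered hT ⟨hd, ha⟩ (covers_vec.2 (by simp))⟩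

theorem covered_right (h : IsCrossMatching g r M) (hρ : IsRoleAssignment g r M ρ)
    (hT : ∀ v, Diag g r M v → v ∈ T) (hT' : ∀ v, v ∈ T ∨ M v ∈ T) (x : W) :
    Covered g r M ρ T (x + g) (x + g + r) := by
  have hlent : Lent g r M ρ x → Covered g r M ρ T (x + g) (x + g + r) := by
    intro hl
    have := (covered_right_of_lends hT hl.1 hl.2).1.symm
    rwa [show x - r + g + r = x + g by grind] at this
  have swap : ∀ a v, HasRole g r M ρ a v → Covers (route g r M ρ a v) (x + g + r) (x + g) →
      Covered g r M ρ T (x + g) (x + g + r) := fun a v hv hc => (hv.covered hT hc).symm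
  by_cases hd : Diag g r M x
  · cases ha : ρ x
    case relay => exact hlent (hρ.relay x ⟨hd, ha⟩)
    case pairSnd => exact swap _ _ (hρ.pairSnd x ⟨hd, ha⟩) (covers_vec.2 (by simp))
    case quadFth => exact swap _ _ (hρ.quadFth x ⟨hd, ha⟩) (covers_vec.2 (by simp))
    case tripSnd => exact swap _ _ (hρ.tripSnd x ⟨hd, ha⟩) (covers_vec.2 (by simp))
    case quadSnd => exact swap _ _ (hρ.quadSnd x ⟨hd, ha⟩) (covers_vec.2 (by simp))
    case quadThd =>
      refine (hρ.quadThd x ⟨hd, ha⟩).covered hT (covers_vec.2 ?_)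
      right; right; right; left
      congr 1 <;> grind
    case row =>
      refine swap _ _ (hρ.row' _ (hρ.row' x ⟨hd, ha⟩)) (covers_vec.2 ?_)
      simp
    all_goals exact HasRole.covered hT ⟨hd, ha⟩ (covers_vec.2 (by simp))
  · by_cases hg : Gap g r M ρ x
    · exact swap _ _ hg (covers_vec.2 (by simp))
    by_cases hl : Lent g r M ρ x
    · exact hlent hl
    have htail : tailEnd g r M ρ x = x + g + r := by simp [tailEnd, hg, hl]
    by_cases hb : Diag g r M (x - g - r)
    swap
    · simpa [htail] using (tail_covered (ρ := ρ) h hT hT' hd fun h' => absurd h' hb).2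
    have hxe : x = x - g - r + g + r := by grind
    rcases (ρ (x - g - r)).keepsTail_or with hk | hk | hk | hk | hk
    · simpa [htail] using (tail_covered h hT hT' hd fun _ => hk).2
    · have := (covered_right_of_lends hT hb hk).2
      rwa [← hxe] at this
    · refine (hρ.quadSnd' _ ⟨hb, hk⟩).covered hT (covers_vec.2 ?_)
      right; right; right; left
      congr 1 <;> grind
    · refine HasRole.covered hT ⟨hb, hk⟩ (covers_vec.2 ?_)
      right; right; right; right
      rw [← hxe, if_neg hg]
      congr 1 <;> grind
    · refine (hρ.row' _ (hρ.row' _ ⟨hb, hk⟩)).covered hT (covers_vec.2 ?_)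
      right; right; right; right
      congr 1 <;> grind

/-- The trail of `x - g` ends with this diagonal. If `x - g` is itself a far end, a role not keeping
that trail is `quadThd`, which tests for the gap, or needs a diagonal at `x - g - r`; the far end of
the latter would be `x`. -/
theorem covered_single (h : IsCrossMatching g r M) (hρ : IsRoleAssignment g r M ρ)
    (hT : ∀ v, Diag g r M v → v ∈ T) (hT' : ∀ v, v ∈ T ∨ M v ∈ T) {x : W}
    (hx : HasRole g r M ρ .single x) : Covered g r M ρ T x (x + g + r) := by
  have hd := hρ.single x hx
  have hgap : Gap g r M ρ (x - g) := by simpa [Gap] using hx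
  have htail : tailEnd g r M ρ (x - g) = x + g + r := by simp [tailEnd, hgap]
  have hcov := tail_covered (ρ := ρ) h hT hT' hd
  rw [htail, sub_add_cancel] at hcov
  by_cases hb : Diag g r M (x - g - g - r)
  swap
  · exact (hcov fun h' => absurd h' hb).2
  have hnot : ¬ Diag g r M (x - g - g - r + g) := fun h' => by
    have := h'.add_left_add_right h
    rw [show x - g - g - r + g + g + r = x by grind] at this
    exact this hx.1
  rcases (ρ (x - g - g - r)).keepsTail_or with hk | (hk | hk) | hk | hk | hk
  · exact (hcov fun _ => hk).2
  · exact absurd (hρ.pairSnd _ ⟨hb, hk⟩).1 hnot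
  · exact absurd (hρ.quadFth _ ⟨hb, hk⟩).1 hnot
  · exact absurd (hρ.quadSnd _ ⟨hb, hk⟩).1 hnot
  · refine HasRole.covered hT ⟨hb, hk⟩ (covers_vec.2 ?_)
    right; right; right; right
    rw [show x - g - g - r + g + r = x - g by grind, if_pos hgap]
    congr 1 <;> grind
  · exact absurd (hρ.row' _ ⟨hb, hk⟩).1 hnot

theorem covered_diag (h : IsCrossMatching g r M) (hρ : IsRoleAssignment g r M ρ)
    (hT : ∀ v, Diag g r M v → v ∈ T) (hT' : ∀ v, v ∈ T ∨ M v ∈ T) {x : W}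
    (hd : Diag g r M x) : Covered g r M ρ T x (x + g + r) := by
  have hM : M x = x + g + r := hd
  have swap : ∀ a v, HasRole g r M ρ a v → Covers (route g r M ρ a v) (x + g + r) x →
      Covered g r M ρ T x (x + g + r) := fun a v hv hc => (hv.covered hT hc).symm
  have e1 : x + r + g = x + g + r := add_right_comm x r g
  cases ha : ρ x
  case single => exact covered_single h hρ hT hT' ⟨hd, ha⟩
  case relay => exact HasRole.covered hT ⟨hd, ha⟩ (covers_relay (by simp [hM]))
  case pairFst => exact (hρ.pairFst x ⟨hd, ha⟩).covered hT (covers_vec.2 (by simp [e1]))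
  case tripFst =>
    refine swap _ _ (hρ.tripSnd' _ (hρ.tripFst x ⟨hd, ha⟩)) (covers_vec.2 ?_)
    left
    congr 1 <;> grind
  case tripThd => exact swap _ _ (hρ.tripThd x ⟨hd, ha⟩) (covers_vec.2 (by simp))
  case quadFst => exact swap _ _ (hρ.quadFst x ⟨hd, ha⟩) (covers_vec.2 (by simp [e1]))
  case quadThd => exact (hρ.quadThd' x ⟨hd, ha⟩).covered hT (covers_vec.2 (by simp [e1]))
  all_goals exact HasRole.covered hT ⟨hd, ha⟩ (covers_vec.2 (by simp))

theorem covered_matching (h : IsCrossMatching g r M) (hρ : IsRoleAssignment g r M ρ)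
    (hT : ∀ v, Diag g r M v → v ∈ T) (hT' : ∀ v, v ∈ T ∨ M v ∈ T) (x : W) :
    Covered g r M ρ T x (M x) := by
  by_cases hd : Diag g r M x
  · have := covered_diag h hρ hT hT' hd
    rwa [show x + g + r = M x from hd.symm] at this
  by_cases hd' : Diag g r M (M x)
  · have := covered_diag h hρ hT hT' hd'
    rw [show M x + g + r = M (M x) from hd'.symm, h.invol] at this
    exact this.symm
  rcases hT' x with hx | hx
  · exact ⟨_, ⟨x, hx, rfl⟩, by rw [routeAt, if_neg hd]; exact covers_relay (by simp)⟩
  · exact ⟨_, ⟨M x, hx, rfl⟩, by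
      rw [routeAt, if_neg hd']; exact covers_relay (by simp [h.invol])⟩

theorem IsCrossMatching.swap (h : IsCrossMatching g r M) : IsCrossMatching r g M where
  invol := h.invol
  ne_self := h.ne_self
  ne_add_left := h.ne_add_right
  ne_sub_left := h.ne_sub_right
  ne_add_right := h.ne_add_left
  ne_sub_right := h.ne_sub_left
  left_ne := h.right_ne
  right_ne := h.left_ne
  two_left_ne := h.two_right_ne
  two_right_ne := h.two_left_ne
  sub_ne := h.sub_ne.symm
  add_ne := by rw [add_comm]; exact h.add_ne
  two_add_ne := by
    have := h.two_add_ne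
    grind

/-! ### One path per matching edge -/

theorem exists_transversal (h : IsCrossMatching g r M) :
    ∃ T : Set W, (∀ v, Diag g r M v → v ∈ T) ∧ (∀ v, v ∈ T ∨ M v ∈ T) ∧
      ∀ v ∈ T, M v ∉ T := by
  classical
  -- The order only selects an end of each matching edge that is not a diagonal.
  let _ : LinearOrder W := linearOrderOfSTO WellOrderingRel
  have hMd : ∀ v, Diag g r M v → ¬ Diag g r M (M v) := fun v hv hv' => by
    have := hv.add_left_add_right h
    rw [show v + g + r = M v from hv.symm] at this
    exact this hv'
  refine ⟨{v | Diag g r M v ∨ (¬ Diag g r M (M v) ∧ v < M v)}, fun v hv => .inl hv, fun v => ?_,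
    fun v hv hv' => ?_⟩
  · simp only [Set.mem_ofPred_eq, h.invol]
    have := lt_or_gt_of_ne (h.ne_self v)
    tauto
  · simp only [Set.mem_ofPred_eq, h.invol] at hv hv'
    have := hMd v
    have := lt_asymm (a := v) (b := M v)
    tauto

theorem exists_routes_aux [Finite W] (h : IsCrossMatching g r M)
    (h32 : g + g + g + r + r ≠ 0) :
    ∃ D : Set (Fin 6 → W), (∀ p ∈ D, IsRoute g r M p) ∧
      (∀ u v, CrossAdj g r M u v → ∃ p ∈ D, Covers p u v) ∧ 2 * D.ncard ≤ Nat.card W := by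
  obtain ⟨ρ, hρ⟩ := exists_isRoleAssignment h
  obtain ⟨T, hT, hT', hT''⟩ := exists_transversal h
  refine ⟨routeAt g r M ρ '' T, ?_, ?_, ?_⟩
  · rintro - ⟨v, hv, rfl⟩
    unfold routeAt
    split_ifs with hd
    · exact isRoute_route h hρ h32 hd
    · exact isRoute_pair h hρ hd fun hd' => hT'' v hv (hT _ hd')
  · have hright : ∀ u, Covered g r M ρ T u (u + r) := fun u => by
      simpa using covered_right h hρ hT hT' (u - g)
    rintro u v (rfl | rfl | rfl | rfl | rfl)
    · exact covered_left h hρ hT hT' u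
    · have := (covered_left h hρ hT hT' (u - g)).symm
      rwa [sub_add_cancel] at this
    · exact hright u
    · have := (hright (u - r)).symm
      rwa [sub_add_cancel] at this
    · exact covered_matching h hρ hT hT' u
  · have hMinj : Function.Injective M := fun a b hab => by rw [← h.invol a, hab, h.invol]
    have hdisj : Disjoint T (M '' T) := by
      rw [Set.disjoint_left]
      rintro - hv ⟨v, hv', rfl⟩
      exact hT'' v hv' hv
    have h1 := Set.ncard_union_eq hdisj
    rw [Set.ncard_image_of_injective T hMinj] at h1
    have h2 : (T ∪ M '' T).ncard ≤ Nat.card W := by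
      rw [← Set.ncard_univ]
      exact Set.ncard_le_ncard (Set.subset_univ _)
    have h3 : (routeAt g r M ρ '' T).ncard ≤ T.ncard := Set.ncard_image_le (Set.toFinite T)
    omega

theorem exists_routes [Finite W] (h : IsCrossMatching g r M) :
    ∃ D : Set (Fin 6 → W), (∀ p ∈ D, IsRoute g r M p) ∧
      (∀ u v, CrossAdj g r M u v → ∃ p ∈ D, Covers p u v) ∧ 2 * D.ncard ≤ Nat.card W := by
  by_cases h32 : g + g + g + r + r = 0
  · have hcomm : ∀ u v, CrossAdj r g M u v ↔ CrossAdj g r M u v := fun u v => by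
      unfold CrossAdj; tauto
    -- If `3g + 2r` and `3r + 2g` both vanished, then `g = r`.
    obtain ⟨D, hD1, hD2, hD3⟩ := exists_routes_aux h.swap (by
      have := h.sub_ne
      grind)
    exact ⟨D, fun p hp => ⟨(hD1 p hp).1, fun i => (hcomm _ _).1 ((hD1 p hp).2 i)⟩,
      fun u v huv => hD2 u v ((hcomm u v).2 huv), hD3⟩
  · exact exists_routes_aux h h32

end

/-! ### From coverings to decompositions -/

/-- The copy of the path with five edges whose vertices are listed by `p`. -/
def copyOfTuple {V : Type*} {G : SimpleGraph V} (p : Fin 6 → V) (hp : Function.Injective p)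
    (hadj : ∀ i : Fin 5, G.Adj (p i.castSucc) (p i.succ)) :
    SimpleGraph.Copy (pathOfLength 5) G where
  toHom :=
    { toFun := p
      map_rel' := by
        have key : ∀ i j : Fin 6, i.val + 1 = j.val → G.Adj (p i) (p j) := by
          intro i j hij
          have h1 : i.val < 5 := by omega
          have h2 : i = (⟨i.val, h1⟩ : Fin 5).castSucc := rfl
          have h3 : j = (⟨i.val, h1⟩ : Fin 5).succ := Fin.ext hij.symm
          rw [h2, h3]
          exact hadj _
        intro i j hij
        rcases SimpleGraph.pathGraph_adj.1 hij with h | h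
        · exact key i j h
        · exact (key j i h).symm }
  injective' := hp

theorem mem_edgeSet_toSubgraph_copyOfTuple {V : Type*} {G : SimpleGraph V} {p : Fin 6 → V}
    {hp : Function.Injective p} {hadj : ∀ i : Fin 5, G.Adj (p i.castSucc) (p i.succ)}
    {e : Sym2 V} :
    e ∈ (copyOfTuple p hp hadj).toSubgraph.edgeSet ↔
      ∃ i : Fin 5, s(p i.castSucc, p i.succ) = e := by
  induction e with
  | _ u v =>
    simp only [SimpleGraph.Subgraph.mem_edgeSet, SimpleGraph.Subgraph.map_adj]
    constructor
    · rintro ⟨i, j, hij, rfl, rfl⟩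
      rcases SimpleGraph.pathGraph_adj.1 hij with h | h
      · have h1 : i.val < 5 := by omega
        refine ⟨⟨i.val, h1⟩, ?_⟩
        rw [show j = (⟨i.val, h1⟩ : Fin 5).succ from Fin.ext h.symm]
        rfl
      · have h1 : j.val < 5 := by omega
        refine ⟨⟨j.val, h1⟩, ?_⟩
        rw [show i = (⟨j.val, h1⟩ : Fin 5).succ from Fin.ext h.symm, Sym2.eq_swap]
        rfl
    · rintro ⟨i, hi⟩
      have h1 : (pathOfLength 5).Adj i.castSucc i.succ :=
        SimpleGraph.pathGraph_adj.2 (.inl (by simp))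
      rcases Sym2.eq_iff.1 hi with ⟨rfl, rfl⟩ | ⟨rfl, rfl⟩
      · exact ⟨_, _, h1, rfl, rfl⟩
      · exact ⟨_, _, h1.symm, rfl, rfl⟩

/-- A family of paths of length five that covers all edges, and has few members, is a
decomposition. -/
theorem admitsDecomposition_of_covers {V : Type*} [Finite V] {G : SimpleGraph V}
    (D : Set (Fin 6 → V)) (hinj : ∀ p ∈ D, Function.Injective p)
    (hadj : ∀ p ∈ D, ∀ i : Fin 5, G.Adj (p i.castSucc) (p i.succ))
    (hcov : ∀ u v, G.Adj u v → ∃ p ∈ D, Covers p u v)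
    (hcard : 5 * D.ncard ≤ Nat.card G.edgeSet) : G.AdmitsDecomposition (pathOfLength 5) := by
  let Φ : D × Fin 5 → G.edgeSet := fun x =>
    ⟨s(x.1.1 x.2.castSucc, x.1.1 x.2.succ), hadj _ x.1.2 x.2⟩
  have hsurj : Function.Surjective Φ := by
    rintro ⟨e, he⟩
    induction e with
    | _ u v =>
      obtain ⟨p, hp, i, hi⟩ := hcov u v he
      exact ⟨(⟨p, hp⟩, i), Subtype.ext hi⟩
  -- A surjection from a set that is no larger is injective, and injectivity is edge-disjointness.
  have hbij : Function.Bijective Φ := by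
    refine hsurj.bijective_of_nat_card_le ?_
    rw [Nat.card_prod, Nat.card_fin, Nat.card_coe_set_eq]
    omega
  let S : D → G.Subgraph := fun p => (copyOfTuple p.1 (hinj _ p.2) (hadj _ p.2)).toSubgraph
  have hS : ∀ p e, e ∈ (S p).edgeSet ↔ ∃ i : Fin 5, s(p.1 i.castSucc, p.1 i.succ) = e :=
    fun p e => mem_edgeSet_toSubgraph_copyOfTuple
  refine ⟨Set.range S, ⟨?_, ?_⟩, ?_⟩
  · rintro - ⟨p, rfl⟩ - ⟨q, rfl⟩ hpq
    refine Set.disjoint_left.2 fun e he he' => hpq ?_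
    obtain ⟨i, hi⟩ := (hS p e).1 he
    obtain ⟨j, hj⟩ := (hS q e).1 he'
    have h1 : Φ (p, i) = Φ (q, j) := Subtype.ext (hi.trans hj.symm)
    rw [(Prod.mk.inj (hbij.1 h1)).1]
  · ext e
    simp only [Set.mem_iUnion]
    constructor
    · rintro ⟨T, -, he⟩
      exact T.edgeSet_subset he
    · intro he
      obtain ⟨⟨p, i⟩, hpi⟩ := hsurj ⟨e, he⟩
      exact ⟨S p, ⟨p, rfl⟩, (hS p e).2 ⟨i, congrArg Subtype.val hpi⟩⟩
  · rintro - ⟨p, rfl⟩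
    exact ⟨(SimpleGraph.Copy.isoToSubgraph _).symm⟩

theorem five_mul_card_of_regular {V : Type*} [Finite V] {G : SimpleGraph V} [G.LocallyFinite]
    (h : G.IsRegularOfDegree 5) : 5 * Nat.card V = 2 * Nat.card G.edgeSet := by
  classical
  have := Fintype.ofFinite V
  have hdeg : ∀ v (i : Fintype (G.neighborSet v)), @SimpleGraph.degree V G v i = 5 :=
    fun v i => by convert h v
  have h1 := G.sum_degrees_eq_twice_card_edges
  simp only [hdeg] at h1
  rw [Nat.card_eq_fintype_card, Nat.card_eq_fintype_card, ← SimpleGraph.edgeFinset_card, ← h1]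
  simp [mul_comm]

/-! ### Reduction to a matching in an abelian group -/

theorem generatedGraph_adj {Γ : Type*} [AddGroup Γ] {g r u v : Γ} :
    (generatedGraph g r).Adj u v ↔
      u ≠ v ∧ (v = u + g ∨ v = u - g ∨ v = u + r ∨ v = u - r) := by
  have h : ∀ x a : Γ, -u + v = a ↔ v = u + a := fun x a => by
    rw [neg_add_eq_iff_eq_add]
  have h' : ∀ a : Γ, -v + u = a ↔ v = u - a := fun a => by
    rw [neg_add_eq_iff_eq_add, eq_sub_iff_add_eq, eq_comm]
  simp only [generatedGraph, SimpleGraph.addCayley_adj, Set.mem_insert_iff,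
    Set.mem_singleton_iff, h u, h', sub_neg_eq_add, ← sub_eq_add_neg]
  tauto

theorem IsSimpleCommutativeGenerator.ne {Γ : Type*} [AddGroup Γ] {g r : Γ}
    (h : IsSimpleCommutativeGenerator g r) :
    g ≠ 0 ∧ r ≠ 0 ∧ g + g ≠ 0 ∧ r + r ≠ 0 ∧ g ≠ r ∧ g + r ≠ 0 := by
  have h1 := h.zero_notMem
  have h2 := h.notMem
  simp only [Set.mem_insert_iff, Set.mem_singleton_iff, two_nsmul, not_or] at h1 h2
  refine ⟨Ne.symm h1.1, Ne.symm h1.2.1, Ne.symm h1.2.2.1, Ne.symm h1.2.2.2, h2.1, ?_⟩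
  rw [Ne, add_eq_zero_iff_eq_neg]
  exact h2.2

/-- The four Cayley neighbours are distinct, so degree five leaves one neighbour; symmetry of both
graphs makes it an involution. -/
theorem IsGeneratedGraph.exists_matching {Γ : Type*} [AddGroup Γ] {g r : Γ}
    {G : SimpleGraph Γ} [G.LocallyFinite] (hG : IsGeneratedGraph g r G) :
    ∃ M : Γ → Γ, (∀ v, M (M v) = v ∧ M v ≠ v ∧ M v ≠ v + g ∧ M v ≠ v - g ∧ M v ≠ v + r ∧
      M v ≠ v - r) ∧
      ∀ u v, G.Adj u v ↔ v = u + g ∨ v = u - g ∨ v = u + r ∨ v = u - r ∨ M u = v := by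
  classical
  obtain ⟨h1, h2, h3, h4, h5, h6⟩ := hG.scg.ne
  have hX : ∀ u v, (v = u + g ∨ v = u - g ∨ v = u + r ∨ v = u - r) → G.Adj u v := by
    intro u v huv
    refine hG.contains (generatedGraph_adj.2 ⟨?_, huv⟩)
    rintro rfl
    rcases huv with h | h | h | h <;> simp [h1, h2, sub_eq_add_neg] at h
  let N : Γ → Finset Γ := fun v => {v + g, v - g, v + r, v - r}
  have hN : ∀ v, (N v).card = 4 := by
    intro v
    have e1 : g ≠ -g := fun h => h3 (add_eq_zero_iff_eq_neg.2 h)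
    have e2 : r ≠ -r := fun h => h4 (add_eq_zero_iff_eq_neg.2 h)
    have e3 : g ≠ -r := fun h => h6 (add_eq_zero_iff_eq_neg.2 h)
    have e4 : -g ≠ r := fun h => e3 (by rw [← h, neg_neg])
    simp [N, sub_eq_add_neg, Finset.card_insert_of_notMem, e1, e2, e3, e4, h5]
  have hsub : ∀ v, N v ⊆ G.neighborFinset v := by
    intro v w hw
    rw [SimpleGraph.mem_neighborFinset]
    exact hX v w (by simpa [N] using hw)
  have hone : ∀ v, ∃ w, G.neighborFinset v \ N v = {w} := by
    intro v
    rw [← Finset.card_eq_one, Finset.card_sdiff_of_subset (hsub v), hN,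
      SimpleGraph.card_neighborFinset_eq_degree, hG.regular v]
  choose M hM using hone
  have hM' : ∀ v w, w = M v ↔ G.Adj v w ∧ w ∉ N v := by
    intro v w
    rw [← Finset.mem_singleton, ← hM, Finset.mem_sdiff, SimpleGraph.mem_neighborFinset]
  have hNsymm : ∀ v w, w ∈ N v → v ∈ N w := by
    intro v w hw
    simp only [N, Finset.mem_insert, Finset.mem_singleton] at hw ⊢
    rcases hw with rfl | rfl | rfl | rfl <;> simp
  refine ⟨M, fun v => ?_, fun u v => ?_⟩
  · obtain ⟨k1, k2⟩ := (hM' v (M v)).1 rfl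
    have k3 := (hM' (M v) v).2 ⟨k1.symm, fun h => k2 (hNsymm _ _ h)⟩
    simp only [N, Finset.mem_insert, Finset.mem_singleton, not_or] at k2
    exact ⟨k3.symm, k1.ne', k2⟩
  · have k1 := hM' u v
    have k2 := hX u v
    simp only [N, Finset.mem_insert, Finset.mem_singleton] at k1
    rw [eq_comm (a := M u)]
    tauto

/-- A group on which two commuting elements act by right translation looks like a commutative
group on which two elements act by translation. -/
theorem exists_equiv_addCommGroup.{u} {Γ : Type u} [AddGroup Γ] [Finite Γ] {g r : Γ}
    (hgr : g + r = r + g) :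
    ∃ (W : Type u) (_ : AddCommGroup W) (e : Γ ≃ W) (g' r' : W),
      (∀ v, e (v + g) = e v + g') ∧ ∀ v, e (v + r) = e v + r' := by
  have hcomm : ∀ x ∈ ({g, r} : Set Γ), ∀ y ∈ ({g, r} : Set Γ), x + y = y + x := by
    rintro x (rfl | rfl) y (rfl | rfl) <;> simp [hgr]
  let A := AddSubgroup.closure ({g, r} : Set Γ)
  let _ : AddCommGroup A :=
    { (inferInstance : AddGroup A) with
      add_comm := (AddSubgroup.isAddCommutative_closure hcomm).is_comm.comm }
  have hgA : g ∈ A := AddSubgroup.subset_closure (by simp)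
  have hrA : r ∈ A := AddSubgroup.subset_closure (by simp)
  have : NeZero (Nat.card (Γ ⧸ A)) := ⟨Nat.card_pos.ne'⟩
  -- Any abelian group structure on the cosets would do, since `g` and `r` do not move the coset
  -- coordinate.
  let f : Γ ⧸ A ≃ ZMod (Nat.card (Γ ⧸ A)) :=
    (Finite.equivFin _).trans (ZMod.finEquiv _).toEquiv
  have hout : ∀ v : Γ, -(QuotientAddGroup.mk v : Γ ⧸ A).out + v ∈ A := fun v =>
    QuotientAddGroup.eq.1 (Quotient.out_eq _)
  let e₀ : Γ ≃ (Γ ⧸ A) × A :=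
    { toFun := fun v => (QuotientAddGroup.mk v, ⟨_, hout v⟩)
      invFun := fun x => x.1.out + x.2
      left_inv := fun v => by simp
      right_inv := fun x => by
        have h : (QuotientAddGroup.mk (x.1.out + (x.2 : Γ)) : Γ ⧸ A) = x.1 := by
          rw [QuotientAddGroup.mk_add_of_mem _ x.2.2]
          exact Quotient.out_eq _
        ext
        · exact h
        · simp [h] }
  have he₀ : ∀ (v : Γ) (a : A), e₀ (v + a) = ((e₀ v).1, (e₀ v).2 + a) := by
    intro v a
    have h : (QuotientAddGroup.mk (v + (a : Γ)) : Γ ⧸ A) = QuotientAddGroup.mk v :=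
      QuotientAddGroup.mk_add_of_mem _ a.2
    refine Prod.ext h (Subtype.ext ?_)
    change -(QuotientAddGroup.mk (v + (a : Γ)) : Γ ⧸ A).out + (v + a) =
      -(QuotientAddGroup.mk v : Γ ⧸ A).out + v + a
    rw [h, add_assoc]
  refine ⟨ZMod (Nat.card (Γ ⧸ A)) × A, inferInstance,
    e₀.trans (Equiv.prodCongr f (Equiv.refl A)), (0, ⟨g, hgA⟩), (0, ⟨r, hrA⟩),
    fun v => ?_, fun v => ?_⟩
  · have := he₀ v ⟨g, hgA⟩
    simp only [Equiv.trans_apply, this]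
    ext <;> simp
  · have := he₀ v ⟨r, hrA⟩
    simp only [Equiv.trans_apply, this]
    ext <;> simp

theorem IsGeneratedGraph.admitsDecomposition {Γ : Type*} [AddGroup Γ] [Finite Γ] {g r : Γ}
    {G : SimpleGraph Γ} [G.LocallyFinite] (hG : IsGeneratedGraph g r G)
    (h2 : 2 • g + 2 • r ≠ 0) : G.AdmitsDecomposition (pathOfLength 5) := by
  obtain ⟨M, hM, hadj⟩ := hG.exists_matching
  obtain ⟨h1, h2', h3, h4, h5, h6⟩ := hG.scg.ne
  obtain ⟨W, _, e, g', r', hg, hr⟩ := exists_equiv_addCommGroup hG.scg.comm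
  have hg' : ∀ v, e (v - g) = e v - g' := fun v => by
    rw [eq_sub_iff_add_eq, ← hg, sub_add_cancel]
  have hr' : ∀ v, e (v - r) = e v - r' := fun v => by
    rw [eq_sub_iff_add_eq, ← hr, sub_add_cancel]
  have hfin : Finite W := Finite.of_equiv _ e
  have hz : ∀ {v : Γ}, e v = e 0 → v = 0 := fun h => e.injective h
  have key : IsCrossMatching g' r' (fun w => e (M (e.symm w))) :=
    { invol := fun w => by simp [(hM _).1]
      ne_self := fun w h => (hM (e.symm w)).2.1 (e.injective (by simpa using h))
      ne_add_left := fun w h => (hM (e.symm w)).2.2.1 (e.injective (by simpa [hg] using h))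
      ne_sub_left := fun w h => (hM (e.symm w)).2.2.2.1 (e.injective (by simpa [hg'] using h))
      ne_add_right := fun w h =>
        (hM (e.symm w)).2.2.2.2.1 (e.injective (by simpa [hr] using h))
      ne_sub_right := fun w h =>
        (hM (e.symm w)).2.2.2.2.2 (e.injective (by simpa [hr'] using h))
      left_ne := fun h => h1 (hz (by rw [← zero_add g, hg, h, add_zero]))
      right_ne := fun h => h2' (hz (by rw [← zero_add r, hr, h, add_zero]))
      two_left_ne := fun h => h3 (hz (by
        rw [← zero_add (g + g), ← add_assoc, hg, hg, add_assoc, h, add_zero]))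
      two_right_ne := fun h => h4 (hz (by
        rw [← zero_add (r + r), ← add_assoc, hr, hr, add_assoc, h, add_zero]))
      sub_ne := fun h => h5 (e.injective (by
        rw [← zero_add g, ← zero_add r, hg, hr, h]))
      add_ne := fun h => h6 (hz (by
        rw [← zero_add (g + r), ← add_assoc, hr, hg, add_assoc, h, add_zero]))
      two_add_ne := fun h => h2 (hz (by
        rw [two_nsmul, two_nsmul, ← zero_add (g + g + (r + r)), ← add_assoc, ← add_assoc,
          ← add_assoc, hr, hr, hg, hg]
        rw [show e 0 + g' + g' + r' + r' = e 0 + (g' + g' + r' + r') by abel, h, add_zero])) }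
  obtain ⟨D, hD1, hD2, hD3⟩ := exists_routes key
  have hcross : ∀ u v, G.Adj u v ↔
      CrossAdj g' r' (fun w => e (M (e.symm w))) (e u) (e v) := by
    intro u v
    simp only [hadj, CrossAdj, ← hg, ← hr, ← hg', ← hr', e.apply_eq_iff_eq,
      Equiv.symm_apply_apply]
  have hinj : Function.Injective fun p : Fin 6 → W => e.symm ∘ p :=
    e.symm.injective.comp_left
  refine admitsDecomposition_of_covers ((fun p => e.symm ∘ p) '' D) ?_ ?_ ?_ ?_
  · rintro - ⟨p, hp, rfl⟩
    exact e.symm.injective.comp (hD1 p hp).1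
  · rintro - ⟨p, hp, rfl⟩ i
    rw [hcross]
    simpa using (hD1 p hp).2 i
  · intro u v huv
    obtain ⟨p, hp, i, hi⟩ := hD2 _ _ ((hcross u v).1 huv)
    refine ⟨_, ⟨p, hp, rfl⟩, i, ?_⟩
    simpa using congrArg (Sym2.map e.symm) hi
  · have h7 := five_mul_card_of_regular hG.regular
    rw [Set.ncard_image_of_injective D hinj]
    rw [Nat.card_congr e] at h7
    omega

theorem IsGeneratedGraph.neg_right {Γ : Type*} [AddGroup Γ] {g r : Γ} {G : SimpleGraph Γ}
    [G.LocallyFinite] (hG : IsGeneratedGraph g r G) : IsGeneratedGraph g (-r) G where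
  scg :=
    { zero_notMem := by
        have := hG.scg.zero_notMem
        simp only [Set.mem_insert_iff, Set.mem_singleton_iff, not_or, eq_comm (a := (0 : Γ)),
          neg_eq_zero, neg_nsmul] at this ⊢
        exact this
      notMem := by
        have := hG.scg.notMem
        simp only [Set.mem_insert_iff, Set.mem_singleton_iff, neg_neg] at this ⊢
        tauto
      comm := (AddCommute.neg_right (a := g) (b := r) hG.scg.comm).eq }
  regular := hG.regular
  contains := by
    refine le_trans (fun u v huv => ?_) hG.contains
    rw [generatedGraph_adj] at huv ⊢
    simp only [sub_neg_eq_add, ← sub_eq_add_neg] at huv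
    tauto

theorem mainTheorem2 {Γ : Type*} [AddGroup Γ] [Finite Γ] (g r : Γ) (G : SimpleGraph Γ)
    [G.LocallyFinite] (hG : IsGeneratedGraph g r G) :
    (2 • g + 2 • r ≠ 0 → G.AdmitsDecomposition (pathOfLength 5)) ∧
    (2 • g + 2 • r ≠ 0 ∨ 2 • g - 2 • r ≠ 0 → G.AdmitsDecomposition (pathOfLength 5)) := by
  refine ⟨hG.admitsDecomposition, ?_⟩
  rintro (h | h)
  · exact hG.admitsDecomposition h
  · exact hG.neg_right.admitsDecomposition (by rwa [neg_nsmul, ← sub_eq_add_neg])
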